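/- Let $\pi : M \to \mathbb{R}$ be a fibration (a smooth surjective submersion), where $M$ is a smooth manifold of dimension $n+1$. Let $\pi_M : T^*M \to M$ be the cotangent bundle and $\tilde\pi_M = \pi\circ\pi_M : T^*M \to \mathbb{R}$. For a manifold $N$, let $\Omega_N = -d\lambda_N$ be the canonical symplectic form of $T^*N$, where $\lambda_N$ is the Liouville $1$-form (so $\Omega_N = dq^a\wedge dp_a$ in canonical coordinates). * Let $J^1\tilde\pi_M$ be the space of $1$-jets of local sections of $\tilde\pi_M$, regarded as a subset of $T(T^*M)$ by identifying the jet of $\sigma$ at $t$ with the velocity $\sigma'(t)$; equivalently, $J^1\tilde\pi_M = \{v \in T(T^*M) : d\tilde\pi_M(v) = 1\}$. Let $\Omega_M^c$ be the complete lift of $\Omega_M$ to $T(T^*M)$, and let $\Omega_{J^1\tilde\pi_M}$ be the pullback of $\Omega_M^c$ along the inclusion $J^1\tilde\pi_M \subset T(T^*M)$. * Let $V_\mu$ be the vector field on $T^*M$ that generates the action $(s,\alpha)\mapsto \alpha + s\,(d\pi)_{\pi_M(\alpha)}$ of $\mathbb{R}$ on $T^*M$. Let $\widehat{V_\mu}^{-1}(1)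 = \{\gamma\in T^*(T^*M) : \gamma(V_\mu) = 1\}$, and let $\Phi$ be the pullback of the canonical symplectic form $\Omega_{T^*M}$ of $T^*(T^*M)$ along the inclusion $\widehat{V_\mu}^{-1}(1)\subset T^*(T^*M)$. * Let $\flat : T(T^*M)\to T^*(T^*M)$, $\flat(v) = \Omega_M(v,\cdot)$. Then $J^1\tilde\pi_M \subset T(T^*M)$ and $\widehat{V_\mu}^{-1}(1)\subset T^*(T^*M)$ are embedded submanifolds of dimension $4n+3$, the forms $\Omega_{J^1\tilde\pi_M}$ and $\Phi$ on them are presymplectic (smooth closed $2$-forms), and $\flat$ restricts to a diffeomorphism $$\tilde b_\pi : J^1\tilde\pi_M \longrightarrow \widehat{V_\mu}^{-1}(1), \qquad \tilde b_\pi(v) = \Omega_M(v,\cdot),$$ which is anti-presymplectic: $$\tilde b_\pi^{\,*}\,\Phi = -\,\Omega_{J^1\tilde\pi_M}.$$ -/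

import Mathlib

open Bundle Manifold Set Topology
open scoped ContDiff Manifold

noncomputable section

namespace TDMech

section Forms

variable {E : Type*} [NormedAddCommGroup E] [NormedSpace ℝ E] {H : Type*} [TopologicalSpace H]
  (I : ModelWithCorners ℝ E H)
  {E' : Type*} [NormedAddCommGroup E'] [NormedSpace ℝ E'] {H' : Type*} [TopologicalSpace H']
  (I' : ModelWithCorners ℝ E' H')
  (N : Type*) [TopologicalSpace N] [ChartedSpace H N]
  {N' : Type*} [TopologicalSpace N'] [ChartedSpace H' N']

/-- (Not necessarily smooth) differential `k`-forms on the manifold `N`. -/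
abbrev DForm (k : ℕ) : Type _ := ∀ x : N, TangentSpace I x [⋀^Fin k]→L[ℝ] ℝ

variable {N} {k : ℕ}

/-- The pullback `f^* θ` of a differential form along a map `f : N → N'`. -/
def pullback (f : N → N') (θ : DForm I' N' k) : DForm I N k := fun x =>
  (θ (f x)).compContinuousLinearMap (mfderiv I I' f x)

/-- The expression of a form in the preferred chart at `x`: the pullback of `θ` along the inverse
of this chart. -/
def inChart (θ : DForm I N k) (x : N) : E → E [⋀^Fin k]→L[ℝ] ℝ := fun y =>
  (θ ((extChartAt I x).symm y)).compContinuousLinearMap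
    (mfderivWithin 𝓘(ℝ, E) I (extChartAt I x).symm (range I) y)

/-- A form is smooth if its expressions in charts are smooth. -/
def IsSmoothForm (θ : DForm I N k) : Prop :=
  ∀ x : N, ContDiffOn ℝ ∞ (inChart I θ x) (extChartAt I x).target

/-- The exterior derivative of a form, computed at `x` in the preferred chart at `x`. -/
def extD (θ : DForm I N k) : DForm I N (k + 1) := fun x =>
  ContinuousAlternatingMap.compContinuousLinearMap
    (extDerivWithin (inChart I θ x) (range I) (extChartAt I x x))
    (mfderiv I 𝓘(ℝ, E) (extChartAt I x) x)

/-- A presymplectic form is a smooth closed `2`-form. -/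
structure IsPresymplectic (θ : DForm I N 2) : Prop where
  smooth : IsSmoothForm I θ
  closed : extD I θ = 0

/-- The contraction `θ(v, ·, …, ·)` of a form with a tangent vector `v` at `x`. -/
def contract (θ : DForm I N (k + 1)) (x : N) (v : TangentSpace I x) :
    TangentSpace I x [⋀^Fin k]→L[ℝ] ℝ :=
  ContinuousAlternatingMap.curryLeft (E := E) (θ x) v

variable [IsManifold I ∞ N]

/-- The contraction `i_T θ` of a `(k+1)`-form on `N` with the tautological vector field along the
projection `τ : TN → N`; it is the `k`-form on `TN` given by
`(i_T θ)_v (w₁, …, w_k) = θ (v, Tτ w₁, …, Tτ w_k)`. -/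
def tautContract (θ : DForm I N (k + 1)) : DForm I.tangent (TangentBundle I N) k := fun v =>
  (contract I θ v.proj v.snd).compContinuousLinearMap
    (mfderiv I.tangent I (fun w : TangentBundle I N => w.proj) v)

/-- The complete (tangent) lift `θ^c = i_T dθ + d i_T θ` of a form on `N` to `TN`. It is the form
with `θ^c (X₁^c, …, X_k^c) = (θ (X₁, …, X_k))^c` for all vector fields `X_i` on `N`; in
coordinates, the complete lift of `dx^a ∧ dx^b` is `dẋ^a ∧ dx^b + dx^a ∧ dẋ^b`. -/
def completeLift (θ : DForm I N (k + 1)) : DForm I.tangent (TangentBundle I N) (k + 1) :=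
  tautContract I (extD I θ) + extD I.tangent (tautContract I θ)

end Forms

section Cotangent

variable {E : Type*} [NormedAddCommGroup E] [NormedSpace ℝ E] {H : Type*} [TopologicalSpace H]
  (I : ModelWithCorners ℝ E H) (N : Type*) [TopologicalSpace N] [ChartedSpace H N]

/-- The model with corners of the cotangent bundle of a manifold with model `I`. -/
abbrev cotModel : ModelWithCorners ℝ (E × (E →L[ℝ] ℝ)) (ModelProd H (E →L[ℝ] ℝ)) :=
  I.prod 𝓘(ℝ, E →L[ℝ] ℝ)

variable [IsManifold I ∞ N]

/-- The cotangent bundle `T^*N`, with its standard structure of a smooth manifold. -/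
abbrev CotangentBundle : Type _ :=
  TotalSpace (E →L[ℝ] ℝ) (fun x : N => TangentSpace I x →L[ℝ] Bundle.Trivial N ℝ x)

variable {N}

/-- The projection `π_N : T^*N → N`. -/
def cotProj (α : CotangentBundle I N) : N := α.proj

/-- The Liouville `1`-form of `T^*N`: `λ_α (X) = α (Tπ_N X)`. -/
def liouville : DForm (cotModel I) (CotangentBundle I N) 1 := fun α =>
  ContinuousAlternatingMap.ofSubsingleton ℝ (TangentSpace (cotModel I) α) ℝ (0 : Fin 1)
    ((show TangentSpace I (cotProj I α) →L[ℝ] ℝ from α.snd).comp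
      (mfderiv (cotModel I) I (cotProj I) α))

/-- The canonical symplectic form `Ω_N = -dλ` of `T^*N`; in coordinates `dq^i ∧ dp_i`. -/
def canonicalForm : DForm (cotModel I) (CotangentBundle I N) 2 := -extD (cotModel I) (liouville I)

/-- The vector bundle morphism `♭_θ : TN → T^*N`, `v ↦ θ(v, ·)`, induced by a `2`-form. -/
def flat (θ : DForm I N 2) (v : TangentBundle I N) : CotangentBundle I N :=
  ⟨v.proj, (ContinuousAlternatingMap.ofSubsingleton ℝ (TangentSpace I v.proj) ℝ (0 : Fin 1)).symm
    (contract I θ v.proj v.snd)⟩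

/-- The linear function `X̂ : T^*N → ℝ`, `γ ↦ γ(X)`, induced by a vector field `X` on `N`. -/
def linearFunction (X : ∀ x : N, TangentSpace I x) (γ : CotangentBundle I N) : ℝ :=
  γ.snd (X γ.proj)

end Cotangent

section Fibration

variable {E : Type*} [NormedAddCommGroup E] [NormedSpace ℝ E] {H : Type*} [TopologicalSpace H]
  (I : ModelWithCorners ℝ E H) {N : Type*} [TopologicalSpace N] [ChartedSpace H N]

/-- A fibration over the real line: a smooth surjective submersion. -/
structure IsFibration (p : N → ℝ) : Prop where
  smooth : ContMDiff I 𝓘(ℝ, ℝ) ∞ p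
  surjective : Function.Surjective p
  submersion : ∀ x : N, Function.Surjective (mfderiv I 𝓘(ℝ, ℝ) p x)

/-- The differential of a function, as a covector at each point. -/
def covector (p : N → ℝ) (x : N) : TangentSpace I x →L[ℝ] ℝ := mfderiv I 𝓘(ℝ, ℝ) p x

/-- The space `J¹p` of `1`-jets of smooth local sections of `p : N → ℝ`, as a subset of `TN`: the
jet at `t` of the local section `σ`, defined on the open set `U ∋ t`, is the velocity `σ'(t)`. -/
def jetSpace (p : N → ℝ) : Set (TangentBundle I N) :=
  {v | ∃ (σ : ℝ → N) (U : Set ℝ) (t : ℝ), IsOpen U ∧ t ∈ U ∧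
    ContMDiffOn 𝓘(ℝ, ℝ) I ∞ σ U ∧ (∀ s ∈ U, p (σ s) = s) ∧
    v = ⟨σ t, mfderiv 𝓘(ℝ, ℝ) I σ t (1 : ℝ)⟩}

/-- A tangent vector `v` is the jet of a local section of `p` if and only if `dp (v) = 1`. -/
theorem mem_jetSpace_iff [I.Boundaryless] [IsManifold I ∞ N] {p : N → ℝ}
    (hp : ContMDiff I 𝓘(ℝ, ℝ) ∞ p) (v : TangentBundle I N) :
    v ∈ jetSpace I p ↔ covector I p v.proj v.snd = 1 := by
  constructor
  · rintro ⟨σ, U, t, hU, ht, hσ, hpσ, rfl⟩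
    have h1 : MDifferentiableAt 𝓘(ℝ, ℝ) I σ t :=
      (hσ.contMDiffAt (hU.mem_nhds ht)).mdifferentiableAt (by simp)
    have h2 : MDifferentiableAt I 𝓘(ℝ, ℝ) p (σ t) := hp.mdifferentiable (by simp) _
    have h3 := mfderiv_comp t h2 h1
    have h4 : mfderiv 𝓘(ℝ, ℝ) 𝓘(ℝ, ℝ) (p ∘ σ) t = mfderiv 𝓘(ℝ, ℝ) 𝓘(ℝ, ℝ) id t := by
      apply Filter.EventuallyEq.mfderiv_eq
      filter_upwards [hU.mem_nhds ht] with s hs using hpσ s hs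
    rw [h4, mfderiv_id] at h3
    exact (congrArg (fun L : ℝ →L[ℝ] ℝ => L 1) h3).symm
  · intro hv
    obtain ⟨x, v⟩ := v
    change mfderiv I 𝓘(ℝ, ℝ) p x v = (1 : ℝ) at hv
    obtain ⟨w, hw⟩ : ∃ w : E, w = v := ⟨v, rfl⟩
    subst hw
    let l : ℝ → E := fun s => extChartAt I x x + s • w
    have hl : ContDiff ℝ ∞ l := by fun_prop
    have hl0 : l 0 = extChartAt I x x := by simp [l]
    set V : Set ℝ := l ⁻¹' (extChartAt I x).target
    have hV : IsOpen V := (isOpen_extChartAt_target x).preimage hl.continuous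
    have h0V : (0 : ℝ) ∈ V := by simp [V, hl0]
    set c : ℝ → N := fun s => (extChartAt I x).symm (l s) with hcdef
    have hc0 : c 0 = x := by simp [c, hl0]
    have hc : ContMDiffOn 𝓘(ℝ, ℝ) I ∞ c V :=
      (contMDiffOn_extChartAt_symm x).comp hl.contMDiff.contMDiffOn (fun s hs => hs)
    have hld : HasMFDerivAt 𝓘(ℝ, ℝ) 𝓘(ℝ, E) l 0
        (ContinuousLinearMap.toSpanSingleton ℝ w) := by
      refine HasFDerivAt.hasMFDerivAt ?_
      have : HasDerivAt l ((1 : ℝ) • w) 0 :=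
        ((hasDerivAt_id (0 : ℝ)).smul_const _).const_add _
      rw [one_smul] at this
      exact this.hasFDerivAt
    have hsd : HasMFDerivAt 𝓘(ℝ, E) I (extChartAt I x).symm (l 0)
        (ContinuousLinearMap.id ℝ E) := by
      rw [hl0]
      have := (mdifferentiableWithinAt_extChartAt_symm (I := I)
        (mem_extChartAt_target x)).hasMFDerivWithinAt
      rw [mfderivWithin_range_extChartAt_symm] at this
      exact this.hasMFDerivAt (by rw [I.range_eq_univ]; exact Filter.univ_mem)
    have hcd : HasMFDerivAt 𝓘(ℝ, ℝ) I c 0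
        (ContinuousLinearMap.toSpanSingleton ℝ w) := hsd.comp 0 hld
    set g : ℝ → ℝ := p ∘ c with hgdef
    have hg : ContDiffOn ℝ ∞ g V := (hp.comp_contMDiffOn hc).contDiffOn
    have hg0 : g 0 = p x := by simp [g, hc0]
    have hg' : HasDerivAt g 1 0 := by
      have h1 : HasMFDerivAt I 𝓘(ℝ, ℝ) p (c 0) (mfderiv I 𝓘(ℝ, ℝ) p (c 0)) :=
        (hp.mdifferentiable (by simp) _).hasMFDerivAt
      have h2 : HasFDerivAt g
          ((show E →L[ℝ] ℝ from mfderiv I 𝓘(ℝ, ℝ) p (c 0)).comp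
            (ContinuousLinearMap.toSpanSingleton ℝ w)) 0 := (h1.comp 0 hcd).hasFDerivAt
      have h3 := h2.hasDerivAt
      have h4 : ((show E →L[ℝ] ℝ from mfderiv I 𝓘(ℝ, ℝ) p (c 0)).comp
            (ContinuousLinearMap.toSpanSingleton ℝ w)) (1 : ℝ) = 1 := by
        rw [hc0, ContinuousLinearMap.comp_apply, ContinuousLinearMap.toSpanSingleton_apply,
          one_smul]
        exact hv
      rwa [h4] at h3
    have hgs := (hg.contDiffAt (hV.mem_nhds h0V))
    have hgf := hg'.hasFDerivAt_equiv one_ne_zero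
    let e := hgs.toOpenPartialHomeomorph g hgf (by simp)
    have he0 : (0 : ℝ) ∈ e.source := hgs.mem_toOpenPartialHomeomorph_source hgf (by simp)
    have heg : ∀ s, e s = g s := fun s => rfl
    have hes : e.symm (p x) = 0 := by rw [← hg0, ← heg, e.left_inv he0]
    have hgd : ContinuousOn (deriv g) V :=
      (hg.continuousOn_deriv_of_isOpen hV (by simp))
    have hW : IsOpen (V ∩ deriv g ⁻¹' {0}ᶜ) :=
      hgd.isOpen_inter_preimage hV isOpen_compl_singleton
    set U := e.target ∩ e.symm ⁻¹' (V ∩ deriv g ⁻¹' {0}ᶜ) with hUdef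
    have hU : IsOpen U := e.symm.isOpen_inter_preimage hW
    have htU : p x ∈ U := by
      refine ⟨?_, ?_⟩
      · rw [← hg0, ← heg]; exact e.map_source he0
      · have h0 : (0 : ℝ) ∈ V ∩ deriv g ⁻¹' {0}ᶜ := ⟨h0V, by simp [hg'.deriv]⟩
        exact Set.mem_preimage.2 (hes.symm ▸ h0 : e.symm (p x) ∈ V ∩ deriv g ⁻¹' {0}ᶜ)
    have hsym : ∀ s ∈ U, ContDiffAt ℝ ∞ e.symm s := by
      rintro s ⟨hs1, hs2, hs3⟩
      have hd := hg.contDiffAt (hV.mem_nhds hs2)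
      exact e.contDiffAt_symm_deriv hs3 hs1 (hd.differentiableAt (by simp)).hasDerivAt hd
    refine ⟨c ∘ e.symm, U, p x, hU, htU, ?_, ?_, ?_⟩
    · refine hc.comp (t := V) (fun s hs => (hsym s hs).contMDiffAt.contMDiffWithinAt) ?_
      exact fun s hs => hs.2.1
    · intro s hs
      exact e.right_inv hs.1
    · have h1 : HasDerivAt e.symm (1 : ℝ)⁻¹ (p x) := by
        refine e.hasDerivAt_symm htU.1 one_ne_zero ?_
        rw [hes]; exact hg'
      have hcd' : HasMFDerivAt 𝓘(ℝ, ℝ) I c (e.symm (p x))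
          (ContinuousLinearMap.toSpanSingleton ℝ w) := by
        rw [hes]; exact hcd
      have h2 := (hcd'.comp (p x) h1.hasFDerivAt.hasMFDerivAt).mfderiv
      have h3 : (mfderiv 𝓘(ℝ, ℝ) I (c ∘ e.symm) (p x)) (1 : ℝ) = w := by
        rw [h2]
        change (((1 : ℝ) • (1 : ℝ)⁻¹ : ℝ)) • w = w
        simp
      have h4 : (c ∘ e.symm) (p x) = x := by
        change c (e.symm (p x)) = x
        rw [hes, hc0]
      refine Bundle.TotalSpace.ext h4.symm ?_
      rw [h3]
      rfl

variable [IsManifold I ∞ N]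

/-- The action of `s ∈ ℝ` on the cotangent bundle determined by `p : N → ℝ`:
translation of covectors by `s • dp`. -/
def cotAction (p : N → ℝ) (s : ℝ) (α : CotangentBundle I N) : CotangentBundle I N :=
  ⟨α.proj, (show TangentSpace I α.proj →L[ℝ] ℝ from α.snd) + s • covector I p α.proj⟩

/-- The infinitesimal generator `V_μ` of this action. -/
def actionGenerator (p : N → ℝ) (α : CotangentBundle I N) : TangentSpace (cotModel I) α :=
  mfderiv 𝓘(ℝ, ℝ) (cotModel I) (fun s : ℝ => cotAction I p s α) 0 (1 : ℝ)

/-- The affine subbundle `V̂_μ⁻¹(1) = {γ | γ(V_μ) = 1}` of `T^*(T^*N)`. -/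
def affineSubbundle (p : N → ℝ) : Set (CotangentBundle (cotModel I) (CotangentBundle I N)) :=
  {γ | linearFunction (cotModel I) (actionGenerator I p) γ = 1}

end Fibration

section Submanifold

variable {F : Type*} [NormedAddCommGroup F] [NormedSpace ℝ F]
  {E : Type*} [NormedAddCommGroup E] [NormedSpace ℝ E] {H : Type*} [TopologicalSpace H]
  (I : ModelWithCorners ℝ E H) {N : Type*} [TopologicalSpace N] [ChartedSpace H N]

/-- A charted space structure on a subset `S ⊆ N` (with the subspace topology) makes `S` an
embedded submanifold of `N`: it is a smooth manifold structure for which the inclusion is a smooth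
embedding. (Such a structure is unique up to the choice of an atlas.) -/
structure IsEmbeddedSubmanifold (S : Set N) (c : ChartedSpace F S) : Prop where
  isManifold : IsManifold 𝓘(ℝ, F) ∞ S
  isSmoothEmbedding : IsSmoothEmbedding 𝓘(ℝ, F) I ∞ ((↑) : S → N)

end Submanifold

section Extended

variable {F : Type*} [NormedAddCommGroup F] [NormedSpace ℝ F]
  {E : Type*} [NormedAddCommGroup E] [NormedSpace ℝ E] {H : Type*} [TopologicalSpace H]
  (I : ModelWithCorners ℝ E H) {N : Type*} [TopologicalSpace N] [ChartedSpace H N]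
  [IsManifold I ∞ N]

/-- The space `J¹(p ∘ π_N) ⊆ T(T^*N)` of `1`-jets of local sections of `p ∘ π_N : T^*N → ℝ`. -/
abbrev extendedJets (p : N → ℝ) : Set (TangentBundle (cotModel I) (CotangentBundle I N)) :=
  jetSpace (cotModel I) (p ∘ cotProj I)

/-- The map `♭_{Ω_N} : T(T^*N) → T^*(T^*N)` induced by the canonical symplectic form of `T^*N`. -/
abbrev flatCanonical (v : TangentBundle (cotModel I) (CotangentBundle I N)) :
    CotangentBundle (cotModel I) (CotangentBundle I N) :=
  flat (cotModel I) (canonicalForm I) v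

/-- The pullback of the complete lift of the canonical symplectic form of `T^*N` along the
inclusion of `J¹(p ∘ π_N)` into `T(T^*N)`. -/
def jetForm (p : N → ℝ) [ChartedSpace F (extendedJets I p)] :
    DForm 𝓘(ℝ, F) (extendedJets I p) 2 :=
  pullback 𝓘(ℝ, F) (cotModel I).tangent Subtype.val
    (completeLift (cotModel I) (canonicalForm I))

/-- The pullback of the canonical symplectic form of `T^*(T^*N)` along the inclusion of
`V̂_μ⁻¹(1)` into `T^*(T^*N)`. -/
def affineForm (p : N → ℝ) [ChartedSpace F (affineSubbundle I p)] :
    DForm 𝓘(ℝ, F) (affineSubbundle I p) 2 :=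
  pullback 𝓘(ℝ, F) (cotModel (cotModel I)) Subtype.val (canonicalForm (cotModel I))

end Extended

end TDMech

end

open TDMech

/-!
Write `Ω` for the canonical symplectic form of `T^*M`, `♭(v) = Ω(v, ·)` and `q = p ∘ π_M`.

In canonical coordinates `Ω = dq^i ∧ dp_i` has constant coefficients (`canonicalForm_coe`), so `♭`
is a fixed linear isomorphism on the fibres in these coordinates and therefore a diffeomorphism from
`T(T^*M)` to `T^*(T^*M)` (`flatDiffeomorph`). For any closed `2`-form `θ`, the tautological property
of the Liouville form says that `♭_θ` pulls `λ` back to the contraction `i_T θ`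
(`pullback_flat_liouville`). Since `dθ = 0`, the complete lift is `θ^c = d (i_T θ)`, so that `♭_θ`
pulls the canonical form `-dλ` back to `-θ^c` (`pullback_flat_canonicalForm`). For `θ = Ω` this is
the asserted identity on the ambient manifolds; it restricts to submanifolds by functoriality of
the pullback (`pullback_restrictDiffeomorph`).

The generator `V_μ` is the vertical vector field with value `dp` (`actionGenerator_eq`), whence
`♭(v)(V_μ) = Ω(v, V_μ) = dq(v)` (`linearFunction_flatCanonical`). Hence `♭` maps the level set
`J¹q = {dq = 1}` onto the level set `{γ(V_μ) = 1}`. The function `dq` on `T(T^*M)` is homogeneous of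
degree one along the fibres, so its derivative along the ray through `v` is `dq(v) = 1` on `J¹q`
(`mfderiv_differential_ne_zero`). Both sets are thus regular level sets, and embedded submanifolds
of codimension one (`exists_isEmbeddedSubmanifold_of_levelSet`). For arbitrary structures of
embedded submanifolds, the restriction of `♭` is smooth because the inclusions are immersions and
topological embeddings.
-/

noncomputable section

namespace TDMech

/-! ### Calculus of differential forms -/

section FormCalculus

variable {E : Type*} [NormedAddCommGroup E] [NormedSpace ℝ E] {H : Type*} [TopologicalSpace H]
  {I : ModelWithCorners ℝ E H}
  {E' : Type*} [NormedAddCommGroup E'] [NormedSpace ℝ E'] {H' : Type*} [TopologicalSpace H']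
  {I' : ModelWithCorners ℝ E' H'}
  {N : Type*} [TopologicalSpace N] [ChartedSpace H N]
  {N' : Type*} [TopologicalSpace N'] [ChartedSpace H' N'] {k : ℕ}

/-- A form as a function with values in the alternating maps on the model space, which is what
all tangent spaces unfold to. -/
def DForm.coe (θ : DForm I N k) : N → E [⋀^Fin k]→L[ℝ] ℝ := θ

theorem DForm.coe_apply_congr (θ : DForm I N k) {x y : N} (h : x = y) {v w : Fin k → E}
    (hv : v = w) : θ.coe x v = θ.coe y w := by
  subst h hv; rfl

theorem two_le_infty : minSmoothness ℝ 2 ≤ (∞ : WithTop ℕ∞) := by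
  rw [minSmoothness_of_isRCLikeNormedField]
  exact WithTop.coe_le_coe.2 (le_top : (2 : ℕ∞) ≤ ⊤)

section AlternatingMap

/-- Alternatization of continuous multilinear maps, as a continuous linear map. Divided by `k!` it
is a left inverse of the inclusion of the alternating maps. -/
def alternatizationCLM (E : Type*) [NormedAddCommGroup E] [NormedSpace ℝ E] (k : ℕ) :
    ContinuousMultilinearMap ℝ (fun _ : Fin k => E) ℝ →L[ℝ] E [⋀^Fin k]→L[ℝ] ℝ :=
  LinearMap.mkContinuous
    { toFun := ContinuousMultilinearMap.alternatization
      map_add' := map_add _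
      map_smul' := fun c m => by
        ext v
        simp [ContinuousMultilinearMap.alternatization_apply_apply, Finset.mul_sum,
          mul_left_comm, Units.smul_def] }
    (Fintype.card (Equiv.Perm (Fin k))) fun m => by
      refine ContinuousAlternatingMap.opNorm_le_bound _
        (mul_nonneg (Nat.cast_nonneg _) (norm_nonneg m)) fun v => ?_
      simp only [LinearMap.coe_mk, AddHom.coe_mk,
        ContinuousMultilinearMap.alternatization_apply_apply]
      refine (norm_sum_le_of_le (f := fun σ : Equiv.Perm (Fin k) => _) _
        (n := fun _ => ‖m‖ * ∏ i, ‖v i‖) fun σ _ => ?_).trans_eq (by simp; ring)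
      have h := m.le_opNorm (v ∘ σ)
      rw [show ∏ i, ‖(v ∘ σ) i‖ = ∏ i, ‖v i‖ from Equiv.prod_comp σ fun i => ‖v i‖] at h
      rcases Int.units_eq_one_or (Equiv.Perm.sign σ) with hs | hs <;> simpa [hs] using h

theorem alternatizationCLM_toContinuousMultilinearMap (η : E [⋀^Fin k]→L[ℝ] ℝ) :
    alternatizationCLM E k η.toContinuousMultilinearMap = (k.factorial : ℝ) • η := by
  ext v
  have h := congrArg (fun a : E [⋀^Fin k]→ₗ[ℝ] ℝ => a v)
    (AlternatingMap.coe_alternatization η.toAlternatingMap)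
  simp only [MultilinearMap.alternatization_apply, AlternatingMap.smul_apply] at h
  change ContinuousMultilinearMap.alternatization _ _ = _
  simp only [ContinuousMultilinearMap.alternatization_apply_apply]
  simpa [Function.comp_def] using h

/-- Smooth dependence of the pullback `η ∘ L` on an alternating form `η` and a linear map `L`.
Multilinear maps have a continuous multilinear operation of composition; alternating maps are
reduced to them by alternatization, which gives back `k!` times the form. -/
theorem _root_.ContDiffAt.compContinuousLinearMap {G : Type*} [NormedAddCommGroup G]
    [NormedSpace ℝ G] {η : G → E' [⋀^Fin k]→L[ℝ] ℝ} {L : G → E →L[ℝ] E'} {y : G} {n : WithTop ℕ∞}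
    (hη : ContDiffAt ℝ n η y) (hL : ContDiffAt ℝ n L y) :
    ContDiffAt ℝ n (fun z => (η z).compContinuousLinearMap (L z)) y := by
  have h1 : ContDiffAt ℝ n (fun z =>
      (ContinuousMultilinearMap.compContinuousLinearMapContinuousMultilinear ℝ
        (fun _ : Fin k => E) (fun _ => E') ℝ (fun _ => L z)) (η z).toContinuousMultilinearMap) y :=
    ContDiffAt.clm_apply
      ((ContinuousMultilinearMap.contDiff _).contDiffAt.comp y (contDiffAt_pi.2 fun _ => hL))
      ((ContinuousAlternatingMap.toContinuousMultilinearMapCLM (𝕜 := ℝ) (E := E') (F := ℝ)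
        (ι := Fin k) ℝ).contDiff.contDiffAt.comp y hη)
  have h2 := ((alternatizationCLM E k).contDiff.contDiffAt.comp y h1).const_smul
    ((k.factorial : ℝ)⁻¹)
  refine h2.congr_of_eventuallyEq (Filter.Eventually.of_forall fun z => ?_)
  have h3 := alternatizationCLM_toContinuousMultilinearMap ((η z).compContinuousLinearMap (L z))
  change _ = (k.factorial : ℝ)⁻¹ •
    alternatizationCLM E k ((η z).compContinuousLinearMap (L z)).toContinuousMultilinearMap
  rw [h3, smul_smul, inv_mul_cancel₀ (by positivity), one_smul]

end AlternatingMap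

theorem hasMFDerivAt_extChartAt_symm [I.Boundaryless] [IsManifold I 1 N] {x : N} {y : E}
    (hy : y ∈ (extChartAt I x).target) :
    HasMFDerivAt 𝓘(ℝ, E) I (extChartAt I x).symm y
      (mfderivWithin 𝓘(ℝ, E) I (extChartAt I x).symm (range I) y) := by
  have h := (mdifferentiableWithinAt_extChartAt_symm (I := I) hy).hasMFDerivWithinAt
  exact h.hasMFDerivAt (by rw [I.range_eq_univ]; exact Filter.univ_mem)

theorem mfderivWithin_range_eq_mfderiv [I.Boundaryless] {f : E → N'} {y : E} :
    mfderivWithin 𝓘(ℝ, E) I' f (range I) y = mfderiv 𝓘(ℝ, E) I' f y := by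
  rw [I.range_eq_univ, mfderivWithin_univ]

/-- The expression of `f^* θ` in charts is the pullback of the expression of `θ` along the
expression of `f`. -/
theorem inChart_pullback [I.Boundaryless] [I'.Boundaryless] [IsManifold I 1 N]
    [IsManifold I' 1 N'] {f : N → N'} (θ : DForm I' N' k)
    {x : N} {x' : N'} {y : E} (hy : y ∈ (extChartAt I x).target)
    (hf : MDifferentiableAt I I' f ((extChartAt I x).symm y))
    (hfy : f ((extChartAt I x).symm y) ∈ (extChartAt I' x').source) :
    inChart I (pullback I I' f θ) x y =
      (inChart I' θ x' ((extChartAt I' x' ∘ f ∘ (extChartAt I x).symm) y)).compContinuousLinearMap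
        (fderiv ℝ (extChartAt I' x' ∘ f ∘ (extChartAt I x).symm) y) := by
  have h1 := hasMFDerivAt_extChartAt_symm hy
  have h2 := hf.hasMFDerivAt.comp y h1
  have h3 : MDifferentiableAt 𝓘(ℝ, E) 𝓘(ℝ, E') (extChartAt I' x' ∘ f ∘ (extChartAt I x).symm) y :=
    (mdifferentiableAt_extChartAt (by rwa [extChartAt_source] at hfy)).comp y h2.mdifferentiableAt
  have h4 := hasMFDerivAt_extChartAt_symm ((extChartAt I' x').map_source hfy)
  have h5 := HasMFDerivAt.comp (f := extChartAt I' x' ∘ f ∘ (extChartAt I x).symm)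
    (g := (extChartAt I' x').symm) y h4 h3.hasMFDerivAt
  have h6 : f ∘ (extChartAt I x).symm =ᶠ[𝓝 y]
      (extChartAt I' x').symm ∘ (extChartAt I' x' ∘ f ∘ (extChartAt I x).symm) := by
    have hc : ContinuousAt (f ∘ (extChartAt I x).symm) y := h2.continuousAt
    filter_upwards [hc.preimage_mem_nhds (extChartAt_source_mem_nhds' hfy)] with z hz
    exact ((extChartAt I' x').left_inv hz).symm
  have h7 := hasMFDerivAt_unique h2 (h5.congr_of_eventuallyEq h6)
  rw [mfderiv_eq_fderiv] at h7
  ext v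
  refine DForm.coe_apply_congr θ h6.eq_of_nhds ?_
  funext i
  exact congrArg (fun L : E →L[ℝ] E' => L (v i)) h7

theorem inChart_modelSpace (θ : DForm 𝓘(ℝ, E) E k) (x : E) :
    inChart 𝓘(ℝ, E) θ x = θ.coe := by
  funext y
  ext v
  refine DForm.coe_apply_congr θ rfl ?_
  funext i
  change (mfderivWithin 𝓘(ℝ, E) 𝓘(ℝ, E) id (range id) y) (v i) = v i
  rw [range_id, mfderivWithin_univ, mfderiv_id]
  rfl

theorem extD_modelSpace (θ : DForm 𝓘(ℝ, E) E k) (x : E) :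
    extD 𝓘(ℝ, E) θ x = extDeriv θ.coe x := by
  ext v
  change (extDerivWithin (inChart 𝓘(ℝ, E) θ x) (range id) x)
    (fun i => mfderiv 𝓘(ℝ, E) 𝓘(ℝ, E) id x (v i)) = _
  rw [inChart_modelSpace, range_id, extDerivWithin_univ, mfderiv_id]
  rfl

theorem IsSmoothForm.contDiffAt [I.Boundaryless] {θ : DForm I N k}
    (hθ : IsSmoothForm I θ) {x : N} {y : E}
    (hy : y ∈ (extChartAt I x).target) : ContDiffAt ℝ ∞ (inChart I θ x) y :=
  (hθ x).contDiffAt ((isOpen_extChartAt_target x).mem_nhds hy)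

/-- Without boundary the targets of the charts are open, so smoothness is a pointwise property. -/
theorem isSmoothForm_iff_contDiffAt [I.Boundaryless] {θ : DForm I N k} :
    IsSmoothForm I θ ↔
      ∀ x : N, ∀ y ∈ (extChartAt I x).target, ContDiffAt ℝ ∞ (inChart I θ x) y :=
  ⟨fun h _ _ hy => h.contDiffAt hy, fun h x y hy => (h x y hy).contDiffWithinAt⟩

theorem _root_.ContMDiffAt.eventually_mdifferentiableAt [IsManifold I 1 N] [IsManifold I' 1 N']
    {f : N → N'} {x : N} (hf : ContMDiffAt I I' ∞ f x) :
    ∀ᶠ z in 𝓝 x, MDifferentiableAt I I' f z := by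
  have : ContMDiffAt I I' 1 f x := hf.of_le (by simp)
  filter_upwards [(contMDiffAt_iff_contMDiffAt_nhds (by simp)).1 this] with z hz
  exact hz.mdifferentiableAt (by simp)

theorem contDiffAt_writtenInCharts [I.Boundaryless] [IsManifold I ∞ N]
    [IsManifold I' ∞ N'] {f : N → N'}
    {x : N} {x' : N'} {y : E} (hy : y ∈ (extChartAt I x).target)
    (hf : ContMDiffAt I I' ∞ f ((extChartAt I x).symm y))
    (hfy : f ((extChartAt I x).symm y) ∈ (extChartAt I' x').source) :
    ContDiffAt ℝ ∞ (extChartAt I' x' ∘ f ∘ (extChartAt I x).symm) y := by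
  have h1 : ContMDiffAt 𝓘(ℝ, E) I ∞ (extChartAt I x).symm y :=
    (contMDiffOn_extChartAt_symm x).contMDiffAt ((isOpen_extChartAt_target x).mem_nhds hy)
  have h2 : ContMDiffAt I' 𝓘(ℝ, E') ∞ (extChartAt I' x') (f ((extChartAt I x).symm y)) :=
    contMDiffAt_extChartAt' (by rwa [extChartAt_source] at hfy)
  exact (h2.comp y (hf.comp y h1)).contDiffAt

theorem eventually_inChart_pullback [I.Boundaryless] [I'.Boundaryless] [IsManifold I ∞ N]
    [IsManifold I' ∞ N'] {f : N → N'}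
    (θ : DForm I' N' k) {x : N} {x' : N'} {y : E} (hy : y ∈ (extChartAt I x).target)
    (hf : ContMDiffAt I I' ∞ f ((extChartAt I x).symm y))
    (hfy : f ((extChartAt I x).symm y) ∈ (extChartAt I' x').source) :
    inChart I (pullback I I' f θ) x =ᶠ[𝓝 y] fun y =>
      (inChart I' θ x' ((extChartAt I' x' ∘ f ∘ (extChartAt I x).symm) y)).compContinuousLinearMap
        (fderiv ℝ (extChartAt I' x' ∘ f ∘ (extChartAt I x).symm) y) := by
  have hc : ContinuousAt (extChartAt I x).symm y := continuousAt_extChartAt_symm'' hy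
  have hd := hc.eventually (ContMDiffAt.eventually_mdifferentiableAt hf)
  have hs := (hf.continuousAt.comp hc).preimage_mem_nhds (extChartAt_source_mem_nhds' hfy)
  filter_upwards [(isOpen_extChartAt_target x).mem_nhds hy, hd, hs] with z h1 h2 h3
  exact inChart_pullback θ h1 h2 h3

theorem contDiffAt_inChart_pullback [I.Boundaryless] [I'.Boundaryless] [IsManifold I ∞ N]
    [IsManifold I' ∞ N'] {f : N → N'}
    {θ : DForm I' N' k} (hθ : IsSmoothForm I' θ) {x : N} {y : E}
    (hy : y ∈ (extChartAt I x).target)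
    (hf : ContMDiffAt I I' ∞ f ((extChartAt I x).symm y)) :
    ContDiffAt ℝ ∞ (inChart I (pullback I I' f θ) x) y := by
  have hfy := mem_extChartAt_source (I := I') (f ((extChartAt I x).symm y))
  refine ContDiffAt.congr_of_eventuallyEq ?_ (eventually_inChart_pullback θ hy hf hfy)
  have hg := contDiffAt_writtenInCharts hy hf hfy
  have hθ' := (hθ.contDiffAt ((extChartAt I' _).map_source hfy))
  exact (hθ'.comp y hg).compContinuousLinearMap (hg.fderiv_right (m := ∞) (by simp))

theorem IsSmoothForm.pullback [I.Boundaryless] [I'.Boundaryless] [IsManifold I ∞ N]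
    [IsManifold I' ∞ N'] {f : N → N'}
    {θ : DForm I' N' k} (hθ : IsSmoothForm I' θ) (hf : ContMDiff I I' ∞ f) :
    IsSmoothForm I (pullback I I' f θ) :=
  isSmoothForm_iff_contDiffAt.2 fun _ _ hy => contDiffAt_inChart_pullback hθ hy (hf _)

/-- The exterior derivative commutes with pullbacks along smooth maps. Only smoothness at one
point is required, so that the lemma applies to inverses of charts. -/
theorem extD_pullback_apply [I.Boundaryless] [I'.Boundaryless] [IsManifold I ∞ N]
    [IsManifold I' ∞ N'] {f : N → N'}
    {θ : DForm I' N' k} (hθ : IsSmoothForm I' θ) {x : N} (hf : ContMDiffAt I I' ∞ f x) :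
    extD I (pullback I I' f θ) x = pullback I I' f (extD I' θ) x := by
  have hy := mem_extChartAt_target (I := I) x
  have hxx : (extChartAt I x).symm (extChartAt I x x) = x := by simp
  have hf' : ContMDiffAt I I' ∞ f ((extChartAt I x).symm (extChartAt I x x)) := by rwa [hxx]
  have hfx := mem_extChartAt_source (I := I') (f x)
  have hfy : f ((extChartAt I x).symm (extChartAt I x x)) ∈ (extChartAt I' (f x)).source := by
    rwa [hxx]
  have hg := contDiffAt_writtenInCharts hy hf' hfy
  have hgx : (extChartAt I' (f x) ∘ f ∘ (extChartAt I x).symm) (extChartAt I x x) =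
    extChartAt I' (f x) (f x) := by simp
  have h1 := (eventually_inChart_pullback θ hy hf' hfy).extDeriv_eq
  have h2 := extDeriv_pullback (r := ∞)
    ((hθ.contDiffAt (by rw [hgx]; exact mem_extChartAt_target _)).differentiableAt (by simp))
    hg two_le_infty
  rw [h2] at h1
  have hd : HasMFDerivAt I 𝓘(ℝ, E') (extChartAt I' (f x) ∘ f) x _ :=
    HasMFDerivAt.comp x (mdifferentiableAt_extChartAt (mem_chart_source H' (f x))).hasMFDerivAt
      (hf.mdifferentiableAt (by simp)).hasMFDerivAt
  have hd2 := HasMFDerivAt.comp (f := extChartAt I x)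
    (g := extChartAt I' (f x) ∘ f ∘ (extChartAt I x).symm) x
    (hg.differentiableAt (by simp)).hasFDerivAt.hasMFDerivAt
      (mdifferentiableAt_extChartAt (mem_chart_source H x)).hasMFDerivAt
  have hev : extChartAt I' (f x) ∘ f =ᶠ[𝓝 x]
      (extChartAt I' (f x) ∘ f ∘ (extChartAt I x).symm) ∘ extChartAt I x := by
    filter_upwards [extChartAt_source_mem_nhds (I := I) x] with z hz
    simp only [Function.comp_apply, (extChartAt I x).left_inv hz]
  have h3 := hasMFDerivAt_unique hd (hd2.congr_of_eventuallyEq hev)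
  ext v
  change (extDerivWithin (inChart I (TDMech.pullback I I' f θ) x) (range I) (extChartAt I x x)) _ =
    (extDerivWithin (inChart I' θ (f x)) (range I') (extChartAt I' (f x) (f x))) _
  rw [I.range_eq_univ, I'.range_eq_univ, extDerivWithin_univ, extDerivWithin_univ, h1, hgx]
  refine congrArg (extDeriv (inChart I' θ (f x)) (extChartAt I' (f x) (f x))) ?_
  funext i
  exact (congrArg (fun L : E →L[ℝ] E' => L (v i)) h3).symm

theorem extD_pullback [I.Boundaryless] [I'.Boundaryless] [IsManifold I ∞ N]
    [IsManifold I' ∞ N'] {f : N → N'}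
    {θ : DForm I' N' k} (hθ : IsSmoothForm I' θ) (hf : ContMDiff I I' ∞ f) :
    extD I (pullback I I' f θ) = pullback I I' f (extD I' θ) :=
  funext fun x => extD_pullback_apply hθ (hf x)

/-- The expression of a form in a chart is a form on the model space, pulled back from `N`. -/
theorem inChart_eq_pullback [I.Boundaryless] (θ : DForm I N k) (x : N) :
    inChart I θ x = (pullback 𝓘(ℝ, E) I (extChartAt I x).symm θ).coe := by
  funext y
  ext v
  refine DForm.coe_apply_congr θ rfl (funext fun i => ?_)
  exact congrArg (fun L : E →L[ℝ] E => L (v i)) mfderivWithin_range_eq_mfderiv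

/-- Exterior derivatives may be computed in any chart, not only in the preferred chart at the
given point. -/
theorem inChart_extD [I.Boundaryless] [IsManifold I ∞ N] {θ : DForm I N k}
    (hθ : IsSmoothForm I θ) {x : N} {y : E}
    (hy : y ∈ (extChartAt I x).target) :
    inChart I (extD I θ) x y = extDeriv (inChart I θ x) y := by
  have h1 : ContMDiffAt 𝓘(ℝ, E) I ∞ (extChartAt I x).symm y :=
    (contMDiffOn_extChartAt_symm x).contMDiffAt ((isOpen_extChartAt_target x).mem_nhds hy)
  rw [inChart_eq_pullback, inChart_eq_pullback, ← extD_modelSpace, extD_pullback_apply hθ h1]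
  rfl

theorem _root_.ContDiffAt.extDeriv {η : E → E [⋀^Fin k]→L[ℝ] ℝ} {y : E} (h : ContDiffAt ℝ ∞ η y) :
    ContDiffAt ℝ ∞ (extDeriv η) y := by
  have h2 := (ContinuousAlternatingMap.alternatizeUncurryFinCLM ℝ E ℝ (n := k)).contDiff (n := ∞)
    |>.contDiffAt.comp y (h.fderiv_right (m := ∞) (by simp))
  refine h2.congr_of_eventuallyEq (Filter.Eventually.of_forall fun z => ?_)
  rw [Function.comp_apply, ContinuousAlternatingMap.alternatizeUncurryFinCLM_apply]
  rfl

theorem IsSmoothForm.extD [I.Boundaryless] [IsManifold I ∞ N] {θ : DForm I N k}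
    (hθ : IsSmoothForm I θ) :
    IsSmoothForm I (extD I θ) := by
  refine isSmoothForm_iff_contDiffAt.2 fun x y hy => ?_
  refine (ContDiffAt.extDeriv (hθ.contDiffAt hy)).congr_of_eventuallyEq ?_
  filter_upwards [(isOpen_extChartAt_target x).mem_nhds hy] with z hz using inChart_extD hθ hz

theorem extD_extD [I.Boundaryless] [IsManifold I ∞ N] {θ : DForm I N k}
    (hθ : IsSmoothForm I θ) :
    extD I (extD I θ) = 0 := by
  funext x
  ext v
  change (extDerivWithin (inChart I (TDMech.extD I θ) x) (range I) (extChartAt I x x)) _ = 0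
  have hy := mem_extChartAt_target (I := I) x
  have h : inChart I (TDMech.extD I θ) x =ᶠ[𝓝 (extChartAt I x x)]
      _root_.extDeriv (inChart I θ x) := by
    filter_upwards [(isOpen_extChartAt_target x).mem_nhds hy] with z hz using inChart_extD hθ hz
  rw [I.range_eq_univ, extDerivWithin_univ, h.extDeriv_eq,
    extDeriv_extDeriv_apply (hθ.contDiffAt hy) two_le_infty]
  rfl

theorem inChart_neg (θ : DForm I N k) (x : N) : inChart I (-θ) x = -inChart I θ x := rfl

theorem IsSmoothForm.neg {θ : DForm I N k} (hθ : IsSmoothForm I θ) : IsSmoothForm I (-θ) :=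
  fun x => (hθ x).neg

theorem extD_neg [I.Boundaryless] (θ : DForm I N k) : extD I (-θ) = -extD I θ := by
  funext x
  ext v
  change (extDerivWithin (inChart I (-θ) x) (range I) (extChartAt I x x)) _ =
    -(extDerivWithin (inChart I θ x) (range I) (extChartAt I x x)) _
  rw [inChart_neg, I.range_eq_univ, extDerivWithin_univ, extDerivWithin_univ]
  -- there is no lemma for `-η`, so it is read as `(-1) • η`
  have := extDeriv_smul (x := extChartAt I x x) (-1 : ℝ) (inChart I θ x)
  rw [neg_one_smul, neg_one_smul] at this
  rw [this]
  rfl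

theorem IsPresymplectic.pullback [I.Boundaryless] [I'.Boundaryless] [IsManifold I ∞ N]
    [IsManifold I' ∞ N'] {f : N → N'}
    {θ : DForm I' N' 2} (hθ : IsPresymplectic I' θ) (hf : ContMDiff I I' ∞ f) :
    IsPresymplectic I (pullback I I' f θ) where
  smooth := hθ.smooth.pullback hf
  closed := by
    rw [extD_pullback hθ.smooth hf, hθ.closed]
    rfl

theorem isPresymplectic_extD [I.Boundaryless] [IsManifold I ∞ N] {θ : DForm I N 1}
    (hθ : IsSmoothForm I θ) :
    IsPresymplectic I (extD I θ) :=
  ⟨hθ.extD, extD_extD hθ⟩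

theorem pullback_comp {E'' : Type*} [NormedAddCommGroup E''] [NormedSpace ℝ E''] {H'' : Type*}
    [TopologicalSpace H''] {I'' : ModelWithCorners ℝ E'' H''}
    {N'' : Type*} [TopologicalSpace N''] [ChartedSpace H'' N'']
    {g : N' → N''} {f : N → N'} (θ : DForm I'' N'' k) (hg : MDifferentiable I' I'' g)
    (hf : MDifferentiable I I' f) :
    pullback I I'' (g ∘ f) θ = pullback I I' f (pullback I' I'' g θ) := by
  funext x
  ext v
  change (θ _) _ = (θ _) _
  rw [mfderiv_comp x (hg _) (hf x)]
  rfl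

end FormCalculus

/-! ### Charts of the tangent and cotangent bundles -/

section Coordinates

variable {E : Type*} [NormedAddCommGroup E] [NormedSpace ℝ E] {H : Type*} [TopologicalSpace H]
  {I : ModelWithCorners ℝ E H} {N : Type*} [TopologicalSpace N] [ChartedSpace H N] {k : ℕ}

variable (I) in
/-- The derivative at `p` of the preferred chart at `x`, as a map of the model space. -/
def chartDeriv (x p : N) : E →L[ℝ] E := mfderiv I 𝓘(ℝ, E) (extChartAt I x) p

variable (I) in
/-- The derivative at `y` of the inverse of the preferred chart at `x`, as a map of the model
space. -/
def chartSymmDeriv (x : N) (y : E) : E →L[ℝ] E :=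
  mfderivWithin 𝓘(ℝ, E) I (extChartAt I x).symm (range I) y

theorem chartSymmDeriv_chartDeriv [IsManifold I 1 N] {x p : N}
    (hp : p ∈ (extChartAt I x).source) (w : E) :
    chartSymmDeriv I x (extChartAt I x p) (chartDeriv I x p w) = w :=
  congrArg (fun L : E →L[ℝ] E => L w) (mfderivWithin_extChartAt_symm_comp_mfderiv_extChartAt' hp)

theorem chartSymmDeriv_self [IsManifold I 1 N] (x : N) (w : E) :
    chartSymmDeriv I x (extChartAt I x x) w = w :=
  congrArg (fun L : E →L[ℝ] E => L w) mfderivWithin_range_extChartAt_symm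

theorem inChart_apply (θ : DForm I N k) (x : N) (y : E) (w : Fin k → E) :
    inChart I θ x y w = θ.coe ((extChartAt I x).symm y) fun i => chartSymmDeriv I x y (w i) := rfl

theorem inChart_self [IsManifold I 1 N] (θ : DForm I N k) (x : N) :
    inChart I θ x (extChartAt I x x) = θ.coe x := by
  ext w
  rw [inChart_apply]
  exact DForm.coe_apply_congr θ (extChartAt_to_inv x) (funext fun i => chartSymmDeriv_self x (w i))

section TotalSpace

variable {F : Type*} [NormedAddCommGroup F] [NormedSpace ℝ F] {V : N → Type*}
  [TopologicalSpace (TotalSpace F V)] [∀ x, TopologicalSpace (V x)] [FiberBundle F V]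

theorem proj_extChartAt_symm {a : TotalSpace F V} {z : E × F}
    (hz : z ∈ (extChartAt (I.prod 𝓘(ℝ, F)) a).target) :
    ((extChartAt (I.prod 𝓘(ℝ, F)) a).symm z).proj = (extChartAt I a.proj).symm z.1 := by
  rw [FiberBundle.extChartAt_target] at hz
  rw [FiberBundle.extChartAt]
  exact (trivializationAt F V a.proj).proj_symm_apply' hz.1.2

theorem fst_mem_target {a : TotalSpace F V} {z : E × F}
    (hz : z ∈ (extChartAt (I.prod 𝓘(ℝ, F)) a).target) : z.1 ∈ (extChartAt I a.proj).target := by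
  rw [FiberBundle.extChartAt_target] at hz
  exact hz.1.1

variable [∀ x, AddCommMonoid (V x)] [∀ x, Module ℝ (V x)] [VectorBundle ℝ F V]
  [ContMDiffVectorBundle ∞ F V I] [IsManifold I ∞ N] [I.Boundaryless]

/-- In the charts of a vector bundle, the differential of the projection is the first
projection. -/
theorem mfderiv_proj_chartSymmDeriv {a : TotalSpace F V} {z : E × F}
    (hz : z ∈ (extChartAt (I.prod 𝓘(ℝ, F)) a).target) (w : E × F) :
    mfderiv (I.prod 𝓘(ℝ, F)) I (fun b : TotalSpace F V => b.proj)
      ((extChartAt (I.prod 𝓘(ℝ, F)) a).symm z) (chartSymmDeriv (I.prod 𝓘(ℝ, F)) a z w) =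
    chartSymmDeriv I a.proj z.1 w.1 := by
  have : IsManifold (I.prod 𝓘(ℝ, F)) ∞ (TotalSpace F V) := inferInstance
  have h1 := hasMFDerivAt_extChartAt_symm hz
  have h2 : MDifferentiableAt (I.prod 𝓘(ℝ, F)) I (fun b : TotalSpace F V => b.proj)
      ((extChartAt (I.prod 𝓘(ℝ, F)) a).symm z) :=
    (contMDiff_proj V (n := ∞)).mdifferentiableAt (by simp)
  have h3 := h2.hasMFDerivAt.comp z h1
  have h4 : HasMFDerivAt 𝓘(ℝ, E × F) 𝓘(ℝ, E) (Prod.fst : E × F → E) z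
      (ContinuousLinearMap.fst ℝ E F) := hasFDerivAt_fst.hasMFDerivAt
  have h5 := (hasMFDerivAt_extChartAt_symm (fst_mem_target hz)).comp z h4
  have h6 : (fun b : TotalSpace F V => b.proj) ∘ (extChartAt (I.prod 𝓘(ℝ, F)) a).symm =ᶠ[𝓝 z]
      (extChartAt I a.proj).symm ∘ Prod.fst := by
    filter_upwards [(isOpen_extChartAt_target a).mem_nhds hz] with y hy
    exact proj_extChartAt_symm hy
  have h7 := hasMFDerivAt_unique h3 (h5.congr_of_eventuallyEq h6)
  exact congrArg (fun L : E × F →L[ℝ] E => L w) h7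

end TotalSpace

section Tangent

variable [IsManifold I ∞ N]

theorem tangent_mem_extChartAt_source {a v : TangentBundle I N} :
    v ∈ (extChartAt I.tangent a).source ↔ v.proj ∈ (extChartAt I a.proj).source := by
  simp only [extChartAt_source, TangentBundle.mem_chart_source_iff]

/-- The charts of `TN`: in the chart at `a`, a vector has the coordinates of its base point and
its image under the differential of the chart of `N` at `a.proj`. -/
theorem extChartAt_tangent {a v : TangentBundle I N}
    (hv : v.proj ∈ (extChartAt I a.proj).source) :
    extChartAt I.tangent a v = (extChartAt I a.proj v.proj, chartDeriv I a.proj v.proj v.snd) := by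
  rw [extChartAt_source] at hv
  rw [FiberBundle.extChartAt]
  refine Prod.ext rfl ?_
  have h := TangentBundle.continuousLinearMapAt_trivializationAt (I := I) hv
  have h' : (trivializationAt E (TangentSpace I) a.proj).continuousLinearMapAt ℝ v.proj v.snd =
      (trivializationAt E (TangentSpace I) a.proj v).2 :=
    congrFun (Trivialization.coe_linearMapAt_of_mem (R := ℝ)
      (trivializationAt E (TangentSpace I) a.proj) hv) v.snd
  exact h'.symm.trans (congrArg (fun L : E →L[ℝ] E => L v.snd) h)

end Tangent

section Cotangent

variable [IsManifold I ∞ N]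

theorem cotangent_mem_extChartAt_source {a γ : CotangentBundle I N} :
    γ ∈ (extChartAt (cotModel I) a).source ↔ γ.proj ∈ (extChartAt I a.proj).source := by
  rw [FiberBundle.extChartAt]
  simp only [PartialEquiv.trans_source, PartialEquiv.prod_source, mem_inter_iff, mem_preimage,
    extChartAt_source, hom_trivializationAt_source, TangentBundle.trivializationAt_baseSet]
  exact ⟨fun h => h.1.1, fun h => ⟨⟨h, trivial⟩, h, trivial⟩⟩

/-- A covector as an element of the dual of the model space, to which the dual of each tangent
space unfolds. -/
def covec (γ : CotangentBundle I N) : E →L[ℝ] ℝ := γ.snd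

/-- The charts of `T^*N`: covectors are transported by the inverse of the differential of the chart
of `N`. -/
theorem extChartAt_cotangent {a γ : CotangentBundle I N}
    (hγ : γ.proj ∈ (extChartAt I a.proj).source) :
    extChartAt (cotModel I) a γ = (extChartAt I a.proj γ.proj,
      (covec γ).comp (chartSymmDeriv I a.proj (extChartAt I a.proj γ.proj))) := by
  rw [extChartAt_source] at hγ
  rw [FiberBundle.extChartAt]
  refine Prod.ext rfl ?_
  have h := TangentBundle.symmL_trivializationAt (I := I) hγ
  have h' : (trivializationAt (E →L[ℝ] ℝ) (fun x : N => TangentSpace I x →L[ℝ] Bundle.Trivial N ℝ x)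
      a.proj γ).2 = (covec γ).comp
      ((trivializationAt E (TangentSpace I) a.proj).symmL ℝ γ.proj : E →L[ℝ] E) := by
    rw [hom_trivializationAt_apply]
    have h0 (r : ℝ) : Trivialization.continuousLinearMapAt ℝ
        (trivializationAt ℝ (Trivial N ℝ) a.proj) γ.proj r = r :=
      congrArg (fun L : ℝ →L[ℝ] ℝ => L r)
        (Bundle.Trivial.continuousLinearMapAt_trivialization (𝕜 := ℝ) N ℝ γ.proj)
    ext w
    exact h0 _
  exact h'.trans (by rw [h]; rfl)

end Cotangent

end Coordinates

/-! ### The canonical forms in coordinates -/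

section CoordinateForms

variable {E : Type*} [NormedAddCommGroup E] [NormedSpace ℝ E] {H : Type*} [TopologicalSpace H]
  {I : ModelWithCorners ℝ E H} {N : Type*} [TopologicalSpace N] [ChartedSpace H N] {k : ℕ}

section Tangent

variable [IsManifold I ∞ N]

/-- A tangent vector as an element of the model space, to which each tangent space unfolds. -/
def vec (v : TangentBundle I N) : E := v.snd

theorem vec_extChartAt_tangent_symm {a : TangentBundle I N} {z : E × E}
    (hz : z ∈ (extChartAt I.tangent a).target) :
    vec ((extChartAt I.tangent a).symm z) = chartSymmDeriv I a.proj z.1 z.2 := by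
  have hs := tangent_mem_extChartAt_source.1 ((extChartAt I.tangent a).map_target hz)
  have h := (extChartAt_tangent hs).symm.trans ((extChartAt I.tangent a).right_inv hz)
  rw [← congrArg Prod.snd h, ← congrArg Prod.fst h]
  exact (chartSymmDeriv_chartDeriv hs _).symm

theorem tautContract_coe (θ : DForm I N (k + 1)) (v : TangentBundle I N) (w : Fin k → E × E) :
    (tautContract I θ).coe v w = θ.coe v.proj (Matrix.vecCons (vec v) fun i =>
      mfderiv I.tangent I (fun w : TangentBundle I N => w.proj) v (w i)) := rfl

theorem tautContract_zero : tautContract I (0 : DForm I N (k + 1)) = 0 := rfl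

/-- For a closed form only the second term of Cartan's formula survives in the complete lift. -/
theorem completeLift_eq_extD {θ : DForm I N (k + 1)} (hθ : extD I θ = 0) :
    completeLift I θ = extD I.tangent (tautContract I θ) := by
  rw [completeLift, hθ, tautContract_zero, zero_add]

variable [I.Boundaryless]

/-- In the charts of `TN`, the form `i_T θ` at `(x, v)` is `θ_x (v, ·, …, ·)` on the components
along the base. -/
theorem inChart_tautContract (θ : DForm I N (k + 1)) {a : TangentBundle I N} {z : E × E}
    (hz : z ∈ (extChartAt I.tangent a).target) :
    inChart I.tangent (tautContract I θ) a z =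
      ((inChart I θ a.proj z.1).curryLeft z.2).compContinuousLinearMap
        (ContinuousLinearMap.fst ℝ E E) := by
  ext w
  rw [inChart_apply, tautContract_coe]
  change _ = θ.coe _ fun i => chartSymmDeriv I a.proj z.1 (Matrix.vecCons z.2 (fun i => (w i).1) i)
  refine DForm.coe_apply_congr θ (proj_extChartAt_symm hz) (funext fun i => ?_)
  refine Fin.cases ?_ (fun i => ?_) i
  · exact vec_extChartAt_tangent_symm hz
  · exact mfderiv_proj_chartSymmDeriv hz (w i)

theorem IsSmoothForm.tautContract {θ : DForm I N (k + 1)} (hθ : IsSmoothForm I θ) :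
    IsSmoothForm I.tangent (tautContract I θ) := by
  refine isSmoothForm_iff_contDiffAt.2 fun a z hz => ?_
  have h1 : ContDiffAt ℝ ∞ (fun y : E × E => inChart I θ a.proj y.1) z :=
    (hθ.contDiffAt (fst_mem_target hz)).comp z contDiffAt_fst
  let C : (E [⋀^Fin (k + 1)]→L[ℝ] ℝ) →L[ℝ] E →L[ℝ] E [⋀^Fin k]→L[ℝ] ℝ :=
    ContinuousAlternatingMap.curryLeftLI.toContinuousLinearMap
  have hC : ContDiff ℝ ∞ C := by fun_prop
  have h2 : ContDiffAt ℝ ∞ (fun y : E × E => C (inChart I θ a.proj y.1)) z :=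
    hC.contDiffAt.comp z h1
  have h3 : ContDiffAt ℝ ∞ (fun y : E × E => (inChart I θ a.proj y.1).curryLeft y.2) z :=
    h2.clm_apply contDiffAt_snd
  refine (h3.compContinuousLinearMap (L := fun _ => ContinuousLinearMap.fst ℝ E E)
    contDiffAt_const).congr_of_eventuallyEq ?_
  filter_upwards [(isOpen_extChartAt_target a).mem_nhds hz] with y hy
  exact inChart_tautContract θ hy

end Tangent

section Cotangent

variable [IsManifold I ∞ N]

theorem covec_extChartAt_cotangent_symm {a : CotangentBundle I N} {z : E × (E →L[ℝ] ℝ)}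
    (hz : z ∈ (extChartAt (cotModel I) a).target) (w : E) :
    covec ((extChartAt (cotModel I) a).symm z) (chartSymmDeriv I a.proj z.1 w) = z.2 w := by
  have hs := cotangent_mem_extChartAt_source.1 ((extChartAt (cotModel I) a).map_target hz)
  have h := (extChartAt_cotangent hs).symm.trans ((extChartAt (cotModel I) a).right_inv hz)
  rw [← congrArg Prod.snd h, ← congrArg Prod.fst h]
  rfl

theorem liouville_coe (α : CotangentBundle I N) (w : Fin 1 → E × (E →L[ℝ] ℝ)) :
    (liouville I).coe α w = covec α
      (mfderiv (cotModel I) I (fun b : CotangentBundle I N => b.proj) α (w 0)) := rfl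

variable (E) in
/-- The Liouville form of `T^*E = E × E^*`: at `(q, a)` it is `(v, b) ↦ a v`. -/
def liouvilleModel : E × (E →L[ℝ] ℝ) →L[ℝ] (E × (E →L[ℝ] ℝ)) [⋀^Fin 1]→L[ℝ] ℝ :=
  (ContinuousAlternatingMap.ofSubsingletonLIE (𝕜 := ℝ) (E := E × (E →L[ℝ] ℝ)) (F := ℝ)
    (0 : Fin 1)).toContinuousLinearEquiv.toContinuousLinearMap ∘L
    ((ContinuousLinearMap.compL ℝ (E × (E →L[ℝ] ℝ)) E ℝ).flip (ContinuousLinearMap.fst ℝ _ _)) ∘L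
    ContinuousLinearMap.snd ℝ _ _

theorem liouvilleModel_apply (z : E × (E →L[ℝ] ℝ)) (w : Fin 1 → E × (E →L[ℝ] ℝ)) :
    liouvilleModel E z w = z.2 (w 0).1 := rfl

variable (E) in
/-- The canonical symplectic form of `T^*E = E × E^*`, which has constant coefficients. -/
def canonicalModel : (E × (E →L[ℝ] ℝ)) [⋀^Fin 2]→L[ℝ] ℝ :=
  -ContinuousAlternatingMap.alternatizeUncurryFin (liouvilleModel E)

theorem canonicalModel_apply (w : Fin 2 → E × (E →L[ℝ] ℝ)) :
    canonicalModel E w = (w 1).2 (w 0).1 - (w 0).2 (w 1).1 := by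
  rw [canonicalModel, ContinuousAlternatingMap.neg_apply,
    ContinuousAlternatingMap.alternatizeUncurryFin_apply, Fin.sum_univ_two]
  simp only [liouvilleModel_apply]
  simp [Fin.removeNth, sub_eq_add_neg]

variable [I.Boundaryless]

/-- In canonical coordinates the Liouville form is `p_i dq^i`. -/
theorem inChart_liouville {a : CotangentBundle I N} {z : E × (E →L[ℝ] ℝ)}
    (hz : z ∈ (extChartAt (cotModel I) a).target) :
    inChart (cotModel I) (liouville I) a z = liouvilleModel E z := by
  ext w
  rw [inChart_apply, liouville_coe, liouvilleModel_apply,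
    ← covec_extChartAt_cotangent_symm hz (w 0).1]
  exact congrArg (covec ((extChartAt (cotModel I) a).symm z))
    (mfderiv_proj_chartSymmDeriv hz (w 0))

theorem isSmoothForm_liouville :
    IsSmoothForm (cotModel I) (liouville I : DForm _ (CotangentBundle I N) 1) :=
  fun _ => (liouvilleModel E).contDiff.contDiffOn.congr fun _ hz => inChart_liouville hz

theorem isPresymplectic_canonicalForm :
    IsPresymplectic (cotModel I) (canonicalForm I : DForm _ (CotangentBundle I N) 2) where
  smooth := isSmoothForm_liouville.extD.neg
  closed := by rw [canonicalForm, extD_neg, extD_extD isSmoothForm_liouville, neg_zero]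

/-- In canonical coordinates the symplectic form is `dq^i ∧ dp_i`. -/
theorem inChart_canonicalForm {a : CotangentBundle I N} {z : E × (E →L[ℝ] ℝ)}
    (hz : z ∈ (extChartAt (cotModel I) a).target) :
    inChart (cotModel I) (canonicalForm I) a z = canonicalModel E := by
  have h : inChart (cotModel I) (liouville I) a =ᶠ[𝓝 z] liouvilleModel E := by
    filter_upwards [(isOpen_extChartAt_target a).mem_nhds hz] with y hy
    exact inChart_liouville hy
  rw [canonicalForm, inChart_neg, Pi.neg_apply, inChart_extD isSmoothForm_liouville hz,
    h.extDeriv_eq, extDeriv, ContinuousLinearMap.fderiv, canonicalModel]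

/-- The value of the symplectic form at any point, in terms of the identification of the tangent
space with `E × E^*` provided by the preferred chart at that same point. -/
theorem canonicalForm_coe (α : CotangentBundle I N) :
    (canonicalForm I).coe α = canonicalModel E := by
  rw [← inChart_self, inChart_canonicalForm (mem_extChartAt_target α)]

end Cotangent

section Flat

theorem covec_flat (θ : DForm I N 2) (v : TangentBundle I N) (w : E) :
    covec (flat I θ v) w = θ.coe v.proj ![vec v, w] := by
  refine DForm.coe_apply_congr θ rfl (funext fun i => ?_)
  fin_cases i <;> rfl

variable [IsManifold I ∞ N]

/-- In coordinates, `♭_θ` is given by the coefficients of `θ`. -/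
theorem extChartAt_flat (θ : DForm I N 2) {a : CotangentBundle I N} {b v : TangentBundle I N}
    (hab : a.proj = b.proj) (hv : v.proj ∈ (extChartAt I b.proj).source) (w : E) :
    (extChartAt (cotModel I) a (flat I θ v)).2 w =
      inChart I θ b.proj (extChartAt I b.proj v.proj) ![(extChartAt I.tangent b v).2, w] := by
  have hv' : (flat I θ v).proj ∈ (extChartAt I a.proj).source := by rwa [hab]
  rw [extChartAt_cotangent hv', extChartAt_tangent hv, inChart_apply, hab]
  refine (covec_flat θ v _).trans ?_
  refine DForm.coe_apply_congr θ ((extChartAt I b.proj).left_inv hv).symm (funext fun i => ?_)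
  fin_cases i
  · exact (chartSymmDeriv_chartDeriv hv _).symm
  · rfl

/-- The tautological property of the Liouville form: `♭_θ` pulls it back to `i_T θ`. -/
theorem pullback_flat_liouville (θ : DForm I N 2)
    (hθ : MDifferentiable I.tangent (cotModel I) (flat I θ)) :
    pullback I.tangent (cotModel I) (flat I θ) (liouville I) = tautContract I θ := by
  funext v
  ext w
  have h1 : MDifferentiableAt (cotModel I) I (fun b : CotangentBundle I N => b.proj)
      (flat I θ v) :=
    (contMDiff_proj (n := ∞) (fun x : N => TangentSpace I x →L[ℝ] Bundle.Trivial N ℝ x))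
      |>.mdifferentiableAt
      (by simp)
  have h2 := mfderiv_comp v h1 (hθ v)
  change covec (flat I θ v) (mfderiv (cotModel I) I (fun b : CotangentBundle I N => b.proj)
    (flat I θ v) (mfderiv I.tangent (cotModel I) (flat I θ) v (w 0))) = _
  have h3 := congrArg (fun L : E × E →L[ℝ] E => covec (flat I θ v) (L (w 0))) h2
  refine h3.symm.trans ?_
  rw [covec_flat]
  change _ = θ.coe v.proj (Matrix.vecCons (vec v) fun i =>
      mfderiv I.tangent I (fun w : TangentBundle I N => w.proj) v (w i))
  refine DForm.coe_apply_congr θ rfl (funext fun i => ?_)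
  fin_cases i <;> rfl

/-- For presymplectic `θ`, the map `♭_θ` pulls `Ω_N = -dλ` back to `-d (i_T θ) = -θ^c`. -/
theorem pullback_flat_canonicalForm [I.Boundaryless] {θ : DForm I N 2} (hθ : IsPresymplectic I θ)
    (h : ContMDiff I.tangent (cotModel I) ∞ (flat I θ)) :
    pullback I.tangent (cotModel I) (flat I θ) (canonicalForm I) = -completeLift I θ := by
  rw [completeLift_eq_extD hθ.closed, ← pullback_flat_liouville θ (h.mdifferentiable (by simp)),
    extD_pullback isSmoothForm_liouville h]
  rfl

end Flat

end CoordinateForms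

/-! ### The diffeomorphism induced by the symplectic form -/

/-- A map that is smooth when read in extended charts at `x` and `x'` is smooth at `x`. -/
theorem contMDiffAt_of_extChartAt_eq {E : Type*} [NormedAddCommGroup E] [NormedSpace ℝ E]
    {H : Type*} [TopologicalSpace H] {I : ModelWithCorners ℝ E H} {N : Type*} [TopologicalSpace N]
    [ChartedSpace H N] [IsManifold I ∞ N]
    {E' : Type*} [NormedAddCommGroup E'] [NormedSpace ℝ E'] {H' : Type*} [TopologicalSpace H']
    {I' : ModelWithCorners ℝ E' H'} [I'.Boundaryless]
    {N' : Type*} [TopologicalSpace N'] [ChartedSpace H' N'] [IsManifold I' ∞ N']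
    {f : N → N'} {x : N} {x' : N'} {g : E → E'} (hg : ContDiff ℝ ∞ g)
    (hs : ∀ v ∈ (extChartAt I x).source, f v ∈ (extChartAt I' x').source)
    (hfg : ∀ v ∈ (extChartAt I x).source, extChartAt I' x' (f v) = g (extChartAt I x v)) :
    ContMDiffAt I I' ∞ f x := by
  have hx := mem_extChartAt_source (I := I) x
  have h1 : ContMDiffAt I 𝓘(ℝ, E) ∞ (extChartAt I x) x := contMDiffAt_extChartAt
  have h2 : ContMDiffAt 𝓘(ℝ, E) 𝓘(ℝ, E') ∞ g (extChartAt I x x) := hg.contMDiff.contMDiffAt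
  have ht : g (extChartAt I x x) ∈ (extChartAt I' x').target := by
    rw [← hfg x hx]
    exact (extChartAt I' x').map_source (hs x hx)
  have h3 : ContMDiffAt 𝓘(ℝ, E') I' ∞ (extChartAt I' x').symm (g (extChartAt I x x)) :=
    (contMDiffOn_extChartAt_symm x').contMDiffAt ((isOpen_extChartAt_target x').mem_nhds ht)
  refine (h3.comp x (h2.comp x h1)).congr_of_eventuallyEq ?_
  filter_upwards [extChartAt_source_mem_nhds (I := I) x] with v hv
  rw [Function.comp_apply, Function.comp_apply, ← hfg v hv, (extChartAt I' x').left_inv (hs v hv)]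

section CanonicalFlat

theorem finrank_dual_eq (X : Type*) [NormedAddCommGroup X] [NormedSpace ℝ X]
    [FiniteDimensional ℝ X] : Module.finrank ℝ (X →L[ℝ] ℝ) = Module.finrank ℝ X := by
  rw [← (LinearMap.toContinuousLinearMap : (X →ₗ[ℝ] ℝ) ≃ₗ[ℝ] X →L[ℝ] ℝ).finrank_eq]
  exact Subspace.dual_finrank_eq

/-- A nondegenerate `2`-form on a finite-dimensional space identifies it with its dual. -/
theorem exists_flat_equiv {X : Type*} [NormedAddCommGroup X] [NormedSpace ℝ X]
    [FiniteDimensional ℝ X] (η : X [⋀^Fin 2]→L[ℝ] ℝ) (h : ∀ v, (∀ w, η ![v, w] = 0) → v = 0) :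
    ∃ A : X ≃L[ℝ] (X →L[ℝ] ℝ), ∀ v w, A v w = η ![v, w] := by
  let A : X →ₗ[ℝ] X →L[ℝ] ℝ :=
    (ContinuousAlternatingMap.ofSubsingletonLIE (𝕜 := ℝ) (E := X) (F := ℝ)
      (0 : Fin 1)).symm.toLinearEquiv.toLinearMap ∘ₗ η.curryLeft.toLinearMap
  have hA (v w : X) : A v w = η ![v, w] := by
    refine congrArg η (funext fun i => ?_)
    fin_cases i <;> rfl
  have hi : Function.Injective A := by
    refine (injective_iff_map_eq_zero A).2 fun v hv => h v fun w => ?_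
    rw [← hA, hv]
    rfl
  exact ⟨(LinearEquiv.ofInjectiveOfFinrankEq A hi
    (finrank_dual_eq X).symm).toContinuousLinearEquiv, hA⟩

variable (E : Type*) [NormedAddCommGroup E] [NormedSpace ℝ E]

theorem canonicalModel_nondegenerate (v : E × (E →L[ℝ] ℝ))
    (h : ∀ w, canonicalModel E ![v, w] = 0) : v = 0 := by
  have h (w : E × (E →L[ℝ] ℝ)) : w.2 v.1 - v.2 w.1 = 0 := by
    rw [← h w, canonicalModel_apply]
    rfl
  refine Prod.ext ?_ (ContinuousLinearMap.ext fun w => ?_)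
  · exact SeparatingDual.eq_zero_of_forall_dual_eq_zero (R := ℝ) fun b => by simpa using h (0, b)
  · simpa using h (w, 0)

variable [FiniteDimensional ℝ E]

/-- The linear isomorphism `♭` of the canonical symplectic form of `T^*E = E × E^*`. -/
def canonicalFlat : (E × (E →L[ℝ] ℝ)) ≃L[ℝ] (E × (E →L[ℝ] ℝ) →L[ℝ] ℝ) :=
  (exists_flat_equiv (canonicalModel E) (canonicalModel_nondegenerate E)).choose

theorem canonicalFlat_apply (v w : E × (E →L[ℝ] ℝ)) :
    canonicalFlat E v w = canonicalModel E ![v, w] :=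
  (exists_flat_equiv (canonicalModel E) (canonicalModel_nondegenerate E)).choose_spec v w

end CanonicalFlat

section FlatCanonical

variable {E : Type*} [NormedAddCommGroup E] [NormedSpace ℝ E] [FiniteDimensional ℝ E]
  {H : Type*} [TopologicalSpace H] {I : ModelWithCorners ℝ E H} [I.Boundaryless]
  {N : Type*} [TopologicalSpace N] [ChartedSpace H N] [IsManifold I ∞ N]

theorem covec_flatCanonical (v : TangentBundle (cotModel I) (CotangentBundle I N)) :
    covec (flatCanonical I v) = canonicalFlat E (vec v) := by
  refine ContinuousLinearMap.ext fun w => ?_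
  rw [covec_flat, canonicalForm_coe, canonicalFlat_apply]

/-- In canonical coordinates, `♭` is a constant linear isomorphism on the fibres, hence smooth with
smooth inverse. -/
theorem extChartAt_flatCanonical {b v : TangentBundle (cotModel I) (CotangentBundle I N)}
    (hv : v ∈ (extChartAt (cotModel I).tangent b).source) :
    extChartAt (cotModel (cotModel I)) (flatCanonical I b) (flatCanonical I v) =
      ((ContinuousLinearEquiv.refl ℝ _).prodCongr (canonicalFlat E))
        (extChartAt (cotModel I).tangent b v) := by
  have hv' := tangent_mem_extChartAt_source.1 hv
  refine Prod.ext ?_ ?_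
  · rw [extChartAt_cotangent (a := flatCanonical I b) (γ := flatCanonical I v) hv',
      extChartAt_tangent hv']
    rfl
  · refine ContinuousLinearMap.ext fun w => ?_
    refine (extChartAt_flat (canonicalForm I) (a := flatCanonical I b) rfl hv' w).trans ?_
    rw [inChart_canonicalForm ((extChartAt (cotModel I) b.proj).map_source hv')]
    exact (canonicalFlat_apply E _ w).symm

variable (I) in
/-- The inverse of `♭` on `T^*(T^*N)`. -/
def sharpCanonical (γ : CotangentBundle (cotModel I) (CotangentBundle I N)) :
    TangentBundle (cotModel I) (CotangentBundle I N) :=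
  ⟨γ.proj, (canonicalFlat E).symm (covec γ)⟩

theorem flatCanonical_sharpCanonical (γ : CotangentBundle (cotModel I) (CotangentBundle I N)) :
    flatCanonical I (sharpCanonical I γ) = γ := by
  have h : covec (flatCanonical I (sharpCanonical I γ)) = covec γ :=
    (covec_flatCanonical _).trans ((canonicalFlat E).apply_symm_apply _)
  exact Bundle.TotalSpace.ext rfl (heq_of_eq h)

theorem sharpCanonical_flatCanonical (v : TangentBundle (cotModel I) (CotangentBundle I N)) :
    sharpCanonical I (flatCanonical I v) = v := by
  have h : (canonicalFlat E).symm (covec (flatCanonical I v)) = vec v := by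
    rw [covec_flatCanonical, ContinuousLinearEquiv.symm_apply_apply]
  exact Bundle.TotalSpace.ext rfl (heq_of_eq h)

theorem contMDiff_flatCanonical :
    ContMDiff (cotModel I).tangent (cotModel (cotModel I)) ∞
      (flatCanonical I (N := N)) := fun b =>
  contMDiffAt_of_extChartAt_eq (x' := flatCanonical I b) (ContinuousLinearEquiv.contDiff _)
    (fun _ hv => cotangent_mem_extChartAt_source.2 (tangent_mem_extChartAt_source.1 hv))
    fun _ hv => extChartAt_flatCanonical hv

theorem contMDiff_sharpCanonical :
    ContMDiff (cotModel (cotModel I)) (cotModel I).tangent ∞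
      (sharpCanonical I (N := N)) := fun γ => by
  refine contMDiffAt_of_extChartAt_eq (x' := sharpCanonical I γ)
    (ContinuousLinearEquiv.contDiff ((ContinuousLinearEquiv.refl ℝ _).prodCongr
      (canonicalFlat E)).symm)
    (fun _ hv => tangent_mem_extChartAt_source.2 (cotangent_mem_extChartAt_source.1 hv))
    fun δ hδ => ?_
  have h := extChartAt_flatCanonical (I := I) (b := sharpCanonical I γ) (v := sharpCanonical I δ)
    (tangent_mem_extChartAt_source.2 (cotangent_mem_extChartAt_source.1 hδ))
  rw [flatCanonical_sharpCanonical, flatCanonical_sharpCanonical] at h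
  rw [h, ContinuousLinearEquiv.symm_apply_apply]

/-- The isomorphism `♭ : T(T^*N) → T^*(T^*N)` induced by the canonical symplectic form. -/
def flatDiffeomorph : TangentBundle (cotModel I) (CotangentBundle I N)
    ≃ₘ^∞⟮(cotModel I).tangent, cotModel (cotModel I)⟯
      CotangentBundle (cotModel I) (CotangentBundle I N) where
  toFun := flatCanonical I
  invFun := sharpCanonical I
  left_inv := sharpCanonical_flatCanonical
  right_inv := flatCanonical_sharpCanonical
  contMDiff_toFun := contMDiff_flatCanonical
  contMDiff_invFun := contMDiff_sharpCanonical

end FlatCanonical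

/-! ### Regular level sets -/

/-- The inverse function theorem, giving a local inverse that is smooth on all of its domain. -/
theorem exists_openPartialHomeomorph_of_hasFDerivAt_id {E : Type*} [NormedAddCommGroup E]
    [NormedSpace ℝ E] [CompleteSpace E] {G : E → E} {U : Set E} (hU : IsOpen U)
    (hG : ContDiffOn ℝ ∞ G U) {y : E} (hy : y ∈ U)
    (h : HasFDerivAt G (ContinuousLinearMap.id ℝ E) y) :
    ∃ ψ : OpenPartialHomeomorph E E, (∀ z, ψ z = G z) ∧ y ∈ ψ.source ∧
      ContDiffOn ℝ ∞ ψ ψ.source ∧ ContDiffOn ℝ ∞ ψ.symm ψ.target := by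
  have hGy : ContDiffAt ℝ ∞ G y := hG.contDiffAt (hU.mem_nhds hy)
  have h' : HasFDerivAt G ((ContinuousLinearEquiv.refl ℝ E : E ≃L[ℝ] E) : E →L[ℝ] E) y := h
  let ψ₀ := hGy.toOpenPartialHomeomorph G h' (by simp)
  have hy₀ : y ∈ ψ₀.source := hGy.mem_toOpenPartialHomeomorph_source h' (by simp)
  have hψ₀ : ∀ z, ψ₀ z = G z := fun z => rfl
  -- the open set where the derivative is invertible
  let V : Set E := U ∩ fderiv ℝ G ⁻¹' range ((↑) : (E ≃L[ℝ] E) → E →L[ℝ] E)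
  have hV : IsOpen V :=
    (hG.continuousOn_fderiv_of_isOpen hU (by simp)).isOpen_inter_preimage hU
      ContinuousLinearEquiv.isOpen
  have hyV : y ∈ V := ⟨hy, ContinuousLinearEquiv.refl ℝ E, h'.fderiv.symm⟩
  let ψ := ψ₀.restrOpen V hV
  have hψ : ∀ z, ψ z = G z := fun z => rfl
  refine ⟨ψ, hψ, ⟨hy₀, hyV⟩, ?_, ?_⟩
  · exact (hG.mono fun z hz => hz.2.1).congr fun z _ => hψ z
  · intro w hw
    have hm : ψ.symm w ∈ ψ.source := ψ.map_target hw
    obtain ⟨hU', A, hA⟩ := hm.2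
    have hd : ContDiffAt ℝ ∞ G (ψ.symm w) := hG.contDiffAt (hU.mem_nhds hU')
    refine (ψ.contDiffAt_symm hw (f₀' := A) ?_ hd).contDiffWithinAt
    rw [hA]
    exact (hd.differentiableAt (by simp)).hasFDerivAt

section LevelSet

variable {E : Type*} [NormedAddCommGroup E] [NormedSpace ℝ E] {H : Type*} [TopologicalSpace H]
  {I : ModelWithCorners ℝ E H} {N : Type*} [TopologicalSpace N]
  {F : Type*} [NormedAddCommGroup F] [NormedSpace ℝ F]

/-- A nonzero linear functional is the last coordinate in a suitable linear coordinate system. -/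
theorem exists_linearEquiv_prod_snd_eq [FiniteDimensional ℝ E] [FiniteDimensional ℝ F]
    (hd : Module.finrank ℝ E = Module.finrank ℝ F + 1) {D : E →L[ℝ] ℝ} (hD : D ≠ 0) :
    ∃ L : E ≃L[ℝ] F × ℝ, ∀ v, (L v).2 = D v := by
  have hD' : (D : E →ₗ[ℝ] ℝ) ≠ 0 := fun h => hD (ContinuousLinearMap.coe_injective h)
  have hk : Module.finrank ℝ (LinearMap.ker (D : E →ₗ[ℝ] ℝ)) = Module.finrank ℝ F := by
    have := Module.Dual.finrank_ker_add_one_of_ne_zero hD'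
    omega
  obtain ⟨u, hu⟩ : ∃ u, D u = 1 := by
    obtain ⟨w, hw⟩ : ∃ w, D w ≠ 0 := by
      by_contra! h
      exact hD (ContinuousLinearMap.ext h)
    exact ⟨(D w)⁻¹ • w, by simp [hw]⟩
  let e : LinearMap.ker (D : E →ₗ[ℝ] ℝ) ≃ₗ[ℝ] F := LinearEquiv.ofFinrankEq _ _ hk
  have hker : ∀ v, v - D v • u ∈ LinearMap.ker (D : E →ₗ[ℝ] ℝ) := fun v => by simp [hu]
  let A : E →ₗ[ℝ] F × ℝ := LinearMap.prod
    (e.toLinearMap ∘ₗ LinearMap.codRestrict _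
      (LinearMap.id - (D : E →ₗ[ℝ] ℝ).smulRight u) hker) (D : E →ₗ[ℝ] ℝ)
  have hA : Function.Injective A := by
    refine (injective_iff_map_eq_zero A).2 fun v hv => ?_
    have h2 : D v = 0 := congrArg Prod.snd hv
    have h1 := congrArg Subtype.val ((e.map_eq_zero_iff).1 (congrArg Prod.fst hv))
    have h1' : v - D v • u = 0 := h1
    simpa [h2] using h1'
  have hfin : Module.finrank ℝ E = Module.finrank ℝ (F × ℝ) := by
    rw [Module.finrank_prod, hd, Module.finrank_self]
  exact ⟨(LinearEquiv.ofInjectiveOfFinrankEq A hA hfin).toContinuousLinearEquiv, fun v => rfl⟩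

open Classical in
/-- The chart of a set `S` obtained from a chart `e` of `N` and linear coordinates `F × ℝ` in which
`S` is given by the vanishing of the last coordinate. -/
def sliceChart [I.Boundaryless] {S : Set N} (e : OpenPartialHomeomorph N H) (L : E ≃L[ℝ] F × ℝ)
    (hS : ∀ z ∈ e.source, z ∈ S ↔ (L (I (e z))).2 = 0) (x : S) : OpenPartialHomeomorph S F where
  toFun z := (L (I (e z))).1
  -- outside the image of the chart, the value of the inverse is irrelevant
  invFun u := if h : e.symm (I.symm (L.symm (u, 0))) ∈ S then ⟨_, h⟩ else x
  source := Subtype.val ⁻¹' e.source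
  target := {u | I.symm (L.symm (u, 0)) ∈ e.target}
  map_source' := by
    intro z hz
    have h0 := (hS z hz).1 z.2
    have h1 : ((L (I (e z))).1, (0 : ℝ)) = L (I (e z)) := Prod.ext rfl h0.symm
    change I.symm (L.symm ((L (I (e z))).1, 0)) ∈ e.target
    rw [h1, L.symm_apply_apply, I.left_inv]
    exact e.map_source hz
  map_target' := by
    intro u hu
    have hm := e.map_target hu
    have h : e.symm (I.symm (L.symm (u, 0))) ∈ S := by
      rw [hS _ hm, e.right_inv hu, I.right_inv (by rw [I.range_eq_univ]; exact mem_univ _),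
        L.apply_symm_apply]
    change Subtype.val (dite _ _ _) ∈ e.source
    rw [dif_pos h]
    exact hm
  left_inv' := by
    intro z hz
    have h0 := (hS z hz).1 z.2
    have h1 : ((L (I (e z))).1, (0 : ℝ)) = L (I (e z)) := Prod.ext rfl h0.symm
    have h2 : e.symm (I.symm (L.symm ((L (I (e z))).1, 0))) = z := by
      rw [h1, L.symm_apply_apply, I.left_inv]
      exact e.left_inv hz
    rw [dif_pos (by rw [h2]; exact z.2)]
    exact Subtype.ext h2
  right_inv' := by
    intro u hu
    have hm := e.map_target hu
    have h1 : L (I (e (e.symm (I.symm (L.symm (u, 0)))))) = (u, 0) := by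
      rw [e.right_inv hu, I.right_inv (by rw [I.range_eq_univ]; exact mem_univ _),
        L.apply_symm_apply]
    have h : e.symm (I.symm (L.symm (u, 0))) ∈ S := by rw [hS _ hm, h1]
    rw [dif_pos h]
    exact congrArg Prod.fst h1
  open_source := e.open_source.preimage continuous_subtype_val
  open_target := e.open_target.preimage (I.continuous_symm.comp (L.symm.continuous.comp
    (continuous_id.prodMk continuous_const)))
  continuousOn_toFun := continuous_fst.comp_continuousOn (L.continuous.comp_continuousOn
    (I.continuous.comp_continuousOn
      (e.continuousOn.comp continuous_subtype_val.continuousOn fun _ hz => hz)))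
  continuousOn_invFun := by
    refine Topology.IsInducing.subtypeVal.continuousOn_iff.2 ?_
    have h1 : ContinuousOn (fun u : F => e.symm (I.symm (L.symm (u, (0 : ℝ)))))
        {u | I.symm (L.symm (u, 0)) ∈ e.target} :=
      e.continuousOn_symm.comp (I.continuous_symm.comp (L.symm.continuous.comp
        (continuous_id.prodMk continuous_const))).continuousOn fun u hu => hu
    refine h1.congr fun u hu => ?_
    have hm := e.map_target hu
    have h : e.symm (I.symm (L.symm (u, 0))) ∈ S := by
      rw [hS _ hm, e.right_inv hu, I.right_inv (by rw [I.range_eq_univ]; exact mem_univ _),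
        L.apply_symm_apply]
    change Subtype.val (dite _ _ _) = _
    rw [dif_pos h]

theorem coe_sliceChart_symm [I.Boundaryless] {S : Set N} {e : OpenPartialHomeomorph N H}
    {L : E ≃L[ℝ] F × ℝ} (hS : ∀ z ∈ e.source, z ∈ S ↔ (L (I (e z))).2 = 0) (x : S) {u : F}
    (hu : I.symm (L.symm (u, 0)) ∈ e.target) :
    ((sliceChart e L hS x).symm u : N) = e.symm (I.symm (L.symm (u, 0))) := by
  have h : e.symm (I.symm (L.symm (u, 0))) ∈ S := by
    rw [hS _ (e.map_target hu), e.right_inv hu,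
      I.right_inv (by rw [I.range_eq_univ]; exact mem_univ _), L.apply_symm_apply]
  exact congrArg Subtype.val (dif_pos h)

variable [ChartedSpace H N]

/-- Around a regular point of `f`, there is a chart of the maximal atlas in which `f - c` is the
last coordinate. -/
theorem exists_sliceChart [FiniteDimensional ℝ E] [FiniteDimensional ℝ F] [I.Boundaryless]
    [IsManifold I ∞ N] (hd : Module.finrank ℝ E = Module.finrank ℝ F + 1) {f : N → ℝ}
    (hf : ContMDiff I 𝓘(ℝ, ℝ) ∞ f) (c : ℝ) {x : N} (hx : mfderiv I 𝓘(ℝ, ℝ) f x ≠ 0) :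
    ∃ (e : OpenPartialHomeomorph N H) (L : E ≃L[ℝ] F × ℝ),
      e ∈ IsManifold.maximalAtlas I ∞ N ∧ x ∈ e.source ∧
      ∀ z ∈ e.source, (L (I (e z))).2 = f z - c := by
  have : CompleteSpace E := FiniteDimensional.complete ℝ E
  set φ := extChartAt I x with hφ
  set g : E → ℝ := f ∘ φ.symm with hgdef
  have hU : IsOpen φ.target := isOpen_extChartAt_target x
  have hy : φ x ∈ φ.target := mem_extChartAt_target x
  have hg : ContDiffOn ℝ ∞ g φ.target :=
    (hf.comp_contMDiffOn (contMDiffOn_extChartAt_symm x)).contDiffOn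
  have hgy : HasFDerivAt g (fderiv ℝ g (φ x)) (φ x) :=
    ((hg.contDiffAt (hU.mem_nhds hy)).differentiableAt (by simp)).hasFDerivAt
  have hD : fderiv ℝ g (φ x) ≠ 0 := by
    have h1 := (hf.mdifferentiableAt (x := x) (by simp)).mfderiv
    rw [I.range_eq_univ, fderivWithin_univ] at h1
    intro h0
    exact hx (h1.trans h0)
  obtain ⟨L, hL⟩ := exists_linearEquiv_prod_snd_eq (F := F) hd hD
  -- `g - c` replaces the last linear coordinate `D` of the chart; to first order nothing changes
  let G : E → E := fun y => L.symm ((L y).1, g y - c)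
  have hG : ContDiffOn ℝ ∞ G φ.target :=
    L.symm.contDiff.comp_contDiffOn
      ((contDiff_fst.comp L.contDiff).contDiffOn.prodMk (hg.sub contDiffOn_const))
  have hGd : HasFDerivAt G (ContinuousLinearMap.id ℝ E) (φ x) := by
    have h1 : HasFDerivAt (fun y => (L y).1)
        ((ContinuousLinearMap.fst ℝ F ℝ).comp (L : E →L[ℝ] F × ℝ)) (φ x) :=
      ((ContinuousLinearMap.fst ℝ F ℝ).comp (L : E →L[ℝ] F × ℝ)).hasFDerivAt
    have h2 := (L.symm : F × ℝ →L[ℝ] E).hasFDerivAt.comp (φ x)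
      (h1.prodMk (hgy.sub_const c))
    refine h2.congr_fderiv (ContinuousLinearMap.ext fun v => ?_)
    change L.symm ((L v).1, fderiv ℝ g (φ x) v) = v
    rw [← hL v]
    exact L.symm_apply_apply v
  obtain ⟨ψ, hψ, hyψ, hψs, hψt⟩ :=
    exists_openPartialHomeomorph_of_hasFDerivAt_id hU hG hy hGd
  let e : OpenPartialHomeomorph N H :=
    (((chartAt H x).trans I.toHomeomorph.toOpenPartialHomeomorph).trans ψ).trans
      I.toHomeomorph.symm.toOpenPartialHomeomorph
  have he : ∀ z, e z = I.symm (ψ (I (chartAt H x z))) := fun z => rfl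
  have he' : ∀ z, e.symm z = (chartAt H x).symm (I.symm (ψ.symm (I z))) := fun z => rfl
  have hes : ∀ z, z ∈ e.source ↔ z ∈ (chartAt H x).source ∧ I (chartAt H x z) ∈ ψ.source := by
    intro z
    simp [e]
  have het : ∀ z, z ∈ e.target ↔ I z ∈ ψ.target ∧
      I.symm (ψ.symm (I z)) ∈ (chartAt H x).target := by
    intro z
    simp [e]
  refine ⟨e, L, ?_, (hes x).2 ⟨mem_chart_source H x, hyψ⟩, ?_⟩
  · refine e.mem_maximalAtlas_of_contMDiffOn ?_ ?_
    · have h1 : ContMDiffOn I 𝓘(ℝ, E) ∞ (fun z => I (chartAt H x z)) e.source :=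
        (I.contMDiff.comp_contMDiffOn contMDiffOn_chart).mono fun z hz => ((hes z).1 hz).1
      have h2 := hψs.contMDiffOn.comp h1 fun z hz => ((hes z).1 hz).2
      exact (I.contMDiffOn_symm.comp h2 fun z _ => by rw [I.range_eq_univ]; exact mem_univ _)
    · have h1 : ContMDiffOn I 𝓘(ℝ, E) ∞ I e.target := I.contMDiff.contMDiffOn
      have h2 := hψt.contMDiffOn.comp h1 fun z hz => ((het z).1 hz).1
      have h3 := I.contMDiffOn_symm.comp (n := ∞) h2 fun z _ => by
        rw [I.range_eq_univ]; exact mem_univ _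
      exact contMDiffOn_chart_symm.comp h3 fun z hz => ((het z).1 hz).2
  · intro z hz
    have hz' := (hes z).1 hz
    rw [he, I.right_inv (by rw [I.range_eq_univ]; exact mem_univ _), hψ]
    change (L (L.symm (_, g (I (chartAt H x z)) - c))).2 = f z - c
    rw [L.apply_symm_apply]
    change f (φ.symm (φ z)) - c = f z - c
    rw [φ.left_inv (by rw [hφ, extChartAt_source]; exact hz'.1)]

/-- The regular level set theorem: a level set of a smooth function whose differential does not
vanish on it is an embedded submanifold of codimension one. -/
theorem exists_isEmbeddedSubmanifold_of_levelSet [FiniteDimensional ℝ E] [FiniteDimensional ℝ F]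
    [I.Boundaryless] [IsManifold I ∞ N] (hd : Module.finrank ℝ E = Module.finrank ℝ F + 1)
    {f : N → ℝ} (hf : ContMDiff I 𝓘(ℝ, ℝ) ∞ f) (c : ℝ) {S : Set N} (hS : ∀ z, z ∈ S ↔ f z = c)
    (hreg : ∀ x ∈ S, mfderiv I 𝓘(ℝ, ℝ) f x ≠ 0) :
    ∃ cS : ChartedSpace F S, IsEmbeddedSubmanifold I S cS := by
  choose e L he hx hL using fun x : S => exists_sliceChart (F := F) hd hf c (hreg x x.2)
  have hSe : ∀ x : S, ∀ z ∈ (e x).source, z ∈ S ↔ (L x (I (e x z))).2 = 0 := fun x z hz => by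
    rw [hL x z hz, hS, sub_eq_zero]
  let C : S → OpenPartialHomeomorph S F := fun x => sliceChart (e x) (L x) (hSe x) x
  let cS : ChartedSpace F S :=
    { atlas := range C
      chartAt := C
      mem_chart_source := hx
      chart_mem_atlas := fun x => mem_range_self x }
  have hC : ∀ x u, I.symm ((L x).symm (u, 0)) ∈ (e x).target →
      ((C x).symm u : N) = (e x).symm (I.symm ((L x).symm (u, 0))) :=
    fun x u hu => coe_sliceChart_symm (hSe x) x hu
  have hman : IsManifold 𝓘(ℝ, F) ∞ S := by
    refine isManifold_of_contDiffOn _ _ _ ?_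
    rintro _ _ ⟨x, rfl⟩ ⟨x', rfl⟩
    let s : Set F := {u | I.symm ((L x).symm (u, 0)) ∈ (e x).target ∧
      (e x).symm (I.symm ((L x).symm (u, 0))) ∈ (e x').source}
    have h1 : ContDiffOn ℝ ∞ (fun u : F => (L x' (I (e x' ((e x).symm
        (I.symm ((L x).symm (u, (0 : ℝ)))))))).1) s := by
      have hc := I.contDiffOn_extendCoordChange (he x) (he x')
      refine (contDiff_fst.comp (L x').contDiff).comp_contDiffOn
        (hc.comp ((L x).symm.contDiff.comp
          (contDiff_id.prodMk contDiff_const)).contDiffOn ?_)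
      intro u hu
      rw [I.extendCoordChange_source, I.image_eq, I.range_eq_univ, inter_univ]
      exact ⟨hu.1, hu.2⟩
    have hs : ∀ u ∈ ((C x).symm.trans (C x')).source, u ∈ s := by
      intro u hu
      refine ⟨hu.1, ?_⟩
      have h2 : ((C x).symm u : N) ∈ (e x').source := hu.2
      rwa [hC x u hu.1] at h2
    refine (h1.mono fun u hu => hs u hu.1).congr fun u hu => ?_
    change (L x' (I (e x' ((C x).symm u : N)))).1 = _
    rw [hC x u hu.1.1]
  refine ⟨cS, hman, ⟨?_, Topology.IsEmbedding.subtypeVal⟩⟩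
  refine IsImmersionOfComplement.isImmersion (F := ℝ) fun x => ?_
  refine IsImmersionAtOfComplement.mk_of_charts (L x).symm (C x) (e x) (hx x) (hx x)
    (StructureGroupoid.subset_maximalAtlas _ (mem_range_self x)) (he x) (fun z hz => hz) ?_
  intro u hu
  have hu' : I.symm ((L x).symm (u, 0)) ∈ (e x).target := by
    rw [(C x).extend_target] at hu
    exact hu.1
  change I (e x ((C x).symm u : N)) = (L x).symm (u, 0)
  rw [hC x u hu', (e x).right_inv hu',
    I.right_inv (by rw [I.range_eq_univ]; exact mem_univ _)]

end LevelSet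

/-! ### The two submanifolds as level sets -/

section Differential

variable {E : Type*} [NormedAddCommGroup E] [NormedSpace ℝ E] {H : Type*} [TopologicalSpace H]
  {I : ModelWithCorners ℝ E H} {N : Type*} [TopologicalSpace N] [ChartedSpace H N]
  [IsManifold I ∞ N]

/-- The velocity of a curve which is a line in the preferred chart at its starting point. -/
theorem hasMFDerivAt_of_extChartAt_eq_line [I.Boundaryless] {c : ℝ → N} {x : N} (hx : c 0 = x)
    {w : E} (hs : ∀ s, c s ∈ (extChartAt I x).source)
    (hc : ∀ s, extChartAt I x (c s) = extChartAt I x x + s • w) :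
    HasMFDerivAt 𝓘(ℝ, ℝ) I c 0 (ContinuousLinearMap.toSpanSingleton ℝ w) := by
  have : IsManifold I 1 N := IsManifold.of_le (n := ∞) (by simp)
  subst hx
  have h0 : extChartAt I (c 0) (c 0) + (0 : ℝ) • w = extChartAt I (c 0) (c 0) := by simp
  have h1 : HasMFDerivAt 𝓘(ℝ, ℝ) 𝓘(ℝ, E) (fun s : ℝ => extChartAt I (c 0) (c 0) + s • w) 0
      (ContinuousLinearMap.toSpanSingleton ℝ w) := by
    have h : HasDerivAt (fun s : ℝ => extChartAt I (c 0) (c 0) + s • w) ((1 : ℝ) • w) 0 :=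
      ((hasDerivAt_id (0 : ℝ)).smul_const _).const_add _
    rw [one_smul] at h
    exact h.hasFDerivAt.hasMFDerivAt
  have h2 := hasMFDerivAt_extChartAt_symm (I := I) (mem_extChartAt_target (I := I) (c 0))
  rw [← h0] at h2
  have h3 := h2.comp (0 : ℝ) h1
  have hcs : c = (extChartAt I (c 0)).symm ∘ fun s : ℝ => extChartAt I (c 0) (c 0) + s • w := by
    funext s
    rw [Function.comp_apply, ← hc s, (extChartAt I (c 0)).left_inv (hs s)]
  rw [← hcs] at h3
  have hd : (chartSymmDeriv I (c 0) (extChartAt I (c 0) (c 0) + (0 : ℝ) • w)).comp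
      (ContinuousLinearMap.toSpanSingleton ℝ w) = ContinuousLinearMap.toSpanSingleton ℝ w := by
    rw [h0]
    refine ContinuousLinearMap.ext fun t => chartSymmDeriv_self (I := I) (c 0) _
  exact hd ▸ h3

/-- The differential of a function `q : N → ℝ`, as a fibrewise linear function on `TN`. -/
def differential (I : ModelWithCorners ℝ E H) (q : N → ℝ) (v : TangentBundle I N) : ℝ :=
  covector I q v.proj v.snd

theorem contMDiff_differential {q : N → ℝ} (hq : ContMDiff I 𝓘(ℝ, ℝ) ∞ q) :
    ContMDiff I.tangent 𝓘(ℝ, ℝ) ∞ (differential I q : TangentBundle I N → ℝ) :=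
  (contMDiff_snd_tangentBundle_modelSpace ℝ 𝓘(ℝ, ℝ)).comp
    (hq.contMDiff_tangentMap (m := ∞) (by simp))

/-- The function `dq` on `TN` is homogeneous along the fibres, so it is regular wherever it does
not vanish. -/
theorem mfderiv_differential_ne_zero [I.Boundaryless] {q : N → ℝ} (hq : ContMDiff I 𝓘(ℝ, ℝ) ∞ q)
    {v : TangentBundle I N} (hv : differential I q v ≠ 0) :
    mfderiv I.tangent 𝓘(ℝ, ℝ) (differential I q) v ≠ 0 := by
  intro h0
  -- differentiate along the ray through `v`
  let c : ℝ → TangentBundle I N := fun s => ⟨v.proj, (1 + s) • v.snd⟩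
  have hc0 : c 0 = v := by simp [c]
  have hm := mem_extChartAt_source (I := I) v.proj
  have hc : HasMFDerivAt 𝓘(ℝ, ℝ) I.tangent c 0 (ContinuousLinearMap.toSpanSingleton ℝ
      ((0, chartDeriv I v.proj v.proj v.snd) : E × E)) := by
    refine hasMFDerivAt_of_extChartAt_eq_line hc0
      (fun s => tangent_mem_extChartAt_source.2 hm) fun s => ?_
    rw [extChartAt_tangent (v := c s) hm, extChartAt_tangent hm]
    refine Prod.ext (by simp [c]) ?_
    change chartDeriv I v.proj v.proj ((1 + s) • (v.snd : E)) =
      chartDeriv I v.proj v.proj v.snd + s • chartDeriv I v.proj v.proj v.snd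
    exact ((chartDeriv I v.proj v.proj).map_smul (1 + s) (vec v)).trans
      (by rw [add_smul, one_smul]; rfl)
  have hf : HasMFDerivAt I.tangent 𝓘(ℝ, ℝ) (differential I q : TangentBundle I N → ℝ) (c 0)
      (mfderiv I.tangent 𝓘(ℝ, ℝ) (differential I q) (c 0)) :=
    ((contMDiff_differential hq).mdifferentiable (by simp) _).hasMFDerivAt
  have h1 := hf.comp (0 : ℝ) hc
  rw [hc0, h0] at h1
  have h2 : HasDerivAt (fun s : ℝ => (1 + s) * differential I q v) 0 0 := by
    have h3 : (differential I q : TangentBundle I N → ℝ) ∘ c =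
        fun s : ℝ => (1 + s) * differential I q v := by
      funext s
      exact (covector I q v.proj).map_smul (1 + s) v.snd
    rw [h3] at h1
    have h4 : HasFDerivAt (fun s : ℝ => (1 + s) * differential I q v) (0 : ℝ →L[ℝ] ℝ) 0 := by
      refine h1.hasFDerivAt.congr_fderiv (ContinuousLinearMap.ext fun t => ?_)
      rfl
    simpa using h4.hasDerivAt
  have h5 : HasDerivAt (fun s : ℝ => (1 + s) * differential I q v)
      (1 * differential I q v) 0 :=
    ((hasDerivAt_id (0 : ℝ)).const_add 1).mul_const _
  rw [one_mul] at h5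
  exact hv (h5.unique h2)

end Differential

section Generator

variable {E : Type*} [NormedAddCommGroup E] [NormedSpace ℝ E] {H : Type*} [TopologicalSpace H]
  {I : ModelWithCorners ℝ E H} {N : Type*} [TopologicalSpace N] [ChartedSpace H N]
  [IsManifold I ∞ N]

theorem contMDiff_cotProj :
    ContMDiff (cotModel I) I ∞ (cotProj I : CotangentBundle I N → N) :=
  contMDiff_proj (fun x : N => TangentSpace I x →L[ℝ] Bundle.Trivial N ℝ x)

/-- The vector field `V_μ` is vertical, with constant value `dp` on each fibre. The components refer
to the preferred chart at `α` itself. -/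
theorem actionGenerator_eq [I.Boundaryless] (p : N → ℝ) (α : CotangentBundle I N) :
    actionGenerator I p α = ((0, covector I p α.proj) : E × (E →L[ℝ] ℝ)) := by
  have : IsManifold I 1 N := IsManifold.of_le (n := ∞) (by simp)
  have hm := mem_extChartAt_source (I := I) α.proj
  have h0 : cotAction I p 0 α = α := by
    simp [cotAction]
  have hw : ∀ L : E →L[ℝ] ℝ,
      L.comp (chartSymmDeriv I α.proj (extChartAt I α.proj α.proj)) = L := fun L =>
    ContinuousLinearMap.ext fun w => congrArg L (chartSymmDeriv_self α.proj w)
  have h := hasMFDerivAt_of_extChartAt_eq_line (I := cotModel I)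
    (c := fun s : ℝ => cotAction I p s α) h0 (w := (0, covector I p α.proj))
    (fun s => cotangent_mem_extChartAt_source.2 hm) fun s => by
      rw [extChartAt_cotangent (γ := cotAction I p s α) hm, extChartAt_cotangent hm]
      refine Prod.ext (by simp [cotAction]) ?_
      exact (hw _).trans (congrArg (· + s • (covector I p α.proj : E →L[ℝ] ℝ)) (hw _).symm)
  have h2 := congrArg (fun L : ℝ →L[ℝ] E × (E →L[ℝ] ℝ) => L 1) h.mfderiv
  exact h2.trans (one_smul ℝ _)

theorem mfderiv_cotProj [I.Boundaryless] (α : CotangentBundle I N) (w : E × (E →L[ℝ] ℝ)) :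
    mfderiv (cotModel I) I (cotProj I) α w = w.1 := by
  have : IsManifold I 1 N := IsManifold.of_le (n := ∞) (by simp)
  have : IsManifold (cotModel I) 1 (CotangentBundle I N) := IsManifold.of_le (n := ∞) (by simp)
  let D : CotangentBundle I N → (E × (E →L[ℝ] ℝ) →L[ℝ] E) := fun β =>
    mfderiv (cotModel I) I (cotProj I) β
  have h : D ((extChartAt (cotModel I) α).symm (extChartAt (cotModel I) α α))
      (chartSymmDeriv (cotModel I) α (extChartAt (cotModel I) α α) w) =
      chartSymmDeriv I α.proj (extChartAt (cotModel I) α α).1 w.1 :=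
    mfderiv_proj_chartSymmDeriv (I := I) (mem_extChartAt_target (I := cotModel I) α) w
  rw [extChartAt_to_inv, chartSymmDeriv_self,
    extChartAt_cotangent (mem_extChartAt_source (I := I) α.proj)] at h
  exact h.trans (chartSymmDeriv_self α.proj w.1)

/-- The differential of `p ∘ π_N` reads only the component along the base. -/
theorem differential_comp_cotProj [I.Boundaryless] {p : N → ℝ} (hp : ContMDiff I 𝓘(ℝ, ℝ) ∞ p)
    (v : TangentBundle (cotModel I) (CotangentBundle I N)) :
    differential (cotModel I) (p ∘ cotProj I) v =
      (covector I p v.proj.proj : E →L[ℝ] ℝ) (vec v).1 := by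
  have h := mfderiv_comp v.proj (hp.mdifferentiable (by simp) (cotProj I v.proj))
    (contMDiff_cotProj.mdifferentiable (by simp) v.proj)
  have h2 := congrArg (fun L : E × (E →L[ℝ] ℝ) →L[ℝ] ℝ => L (vec v)) h
  exact h2.trans (congrArg (covector I p v.proj.proj : E →L[ℝ] ℝ) (mfderiv_cotProj v.proj (vec v)))

/-- Under `♭` the linear function of `V_μ` becomes the differential of `p ∘ π_N`, that is,
`Ω(v, V_μ) = d(p ∘ π_N)(v)`. -/
theorem linearFunction_flatCanonical [I.Boundaryless] {p : N → ℝ} (hp : ContMDiff I 𝓘(ℝ, ℝ) ∞ p)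
    (v : TangentBundle (cotModel I) (CotangentBundle I N)) :
    linearFunction (cotModel I) (actionGenerator I p) (flatCanonical I v) =
      differential (cotModel I) (p ∘ cotProj I) v := by
  rw [differential_comp_cotProj hp]
  refine (covec_flat (canonicalForm I) v (actionGenerator I p v.proj)).trans ?_
  rw [canonicalForm_coe, actionGenerator_eq, canonicalModel_apply]
  change covector I p v.proj.proj (vec v).1 - (vec v).2 (0 : E) = _
  rw [map_zero, sub_zero]

theorem mem_extendedJets_iff [I.Boundaryless] {p : N → ℝ} (hp : ContMDiff I 𝓘(ℝ, ℝ) ∞ p)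
    (v : TangentBundle (cotModel I) (CotangentBundle I N)) :
    v ∈ extendedJets I p ↔ differential (cotModel I) (p ∘ cotProj I) v = 1 :=
  mem_jetSpace_iff (cotModel I) (hp.comp contMDiff_cotProj) v

/-- `♭` exchanges `J¹(p ∘ π_N)` and `V̂_μ⁻¹(1)`. -/
theorem flatCanonical_mem_affineSubbundle_iff [I.Boundaryless] {p : N → ℝ}
    (hp : ContMDiff I 𝓘(ℝ, ℝ) ∞ p) (v : TangentBundle (cotModel I) (CotangentBundle I N)) :
    flatCanonical I v ∈ affineSubbundle I p ↔ v ∈ extendedJets I p := by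
  rw [mem_extendedJets_iff hp, ← linearFunction_flatCanonical hp]
  rfl

end Generator

section Submanifolds

variable {E : Type*} [NormedAddCommGroup E] [NormedSpace ℝ E] [FiniteDimensional ℝ E]
  {H : Type*} [TopologicalSpace H]
  {I : ModelWithCorners ℝ E H} {N : Type*} [TopologicalSpace N] [ChartedSpace H N]
  [IsManifold I ∞ N] [I.Boundaryless] {p : N → ℝ}
  {F : Type*} [NormedAddCommGroup F] [NormedSpace ℝ F]

section Existence

variable [FiniteDimensional ℝ F]

theorem exists_isEmbeddedSubmanifold_extendedJets
    (hd : 4 * Module.finrank ℝ E = Module.finrank ℝ F + 1) (hp : ContMDiff I 𝓘(ℝ, ℝ) ∞ p) :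
    ∃ c : ChartedSpace F (extendedJets I p),
      IsEmbeddedSubmanifold (cotModel I).tangent (extendedJets I p) c := by
  have hq : ContMDiff (cotModel I) 𝓘(ℝ, ℝ) ∞ (p ∘ cotProj I) := hp.comp contMDiff_cotProj
  refine exists_isEmbeddedSubmanifold_of_levelSet ?_ (contMDiff_differential hq) 1
    (mem_extendedJets_iff hp) fun v hv => mfderiv_differential_ne_zero hq ?_
  · rw [Module.finrank_prod, Module.finrank_prod, finrank_dual_eq]
    omega
  · rw [(mem_extendedJets_iff hp v).1 hv]
    exact one_ne_zero

/-- The function `γ ↦ γ(V_μ)` corresponds under `♭` to `d(p ∘ π_N)`, and so it inherits smoothness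
and regularity. -/
theorem exists_isEmbeddedSubmanifold_affineSubbundle
    (hd : 4 * Module.finrank ℝ E = Module.finrank ℝ F + 1) (hp : ContMDiff I 𝓘(ℝ, ℝ) ∞ p) :
    ∃ c : ChartedSpace F (affineSubbundle I p),
      IsEmbeddedSubmanifold (cotModel (cotModel I)) (affineSubbundle I p) c := by
  have hq : ContMDiff (cotModel I) 𝓘(ℝ, ℝ) ∞ (p ∘ cotProj I) := hp.comp contMDiff_cotProj
  set f : CotangentBundle (cotModel I) (CotangentBundle I N) → ℝ :=
    linearFunction (cotModel I) (actionGenerator I p) with hfdef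
  have hff (v) : f (flatCanonical I v) = differential (cotModel I) (p ∘ cotProj I) v :=
    linearFunction_flatCanonical hp v
  have hf : ContMDiff (cotModel (cotModel I)) 𝓘(ℝ, ℝ) ∞ f := by
    refine ((contMDiff_differential hq).comp contMDiff_sharpCanonical).congr fun γ => ?_
    rw [Function.comp_apply, ← hff, flatCanonical_sharpCanonical]
  refine exists_isEmbeddedSubmanifold_of_levelSet ?_ hf 1 (fun γ => Iff.rfl) fun γ hγ h0 => ?_
  · rw [Module.finrank_prod, finrank_dual_eq, Module.finrank_prod, finrank_dual_eq]
    omega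
  · obtain ⟨v, rfl⟩ : ∃ v, flatCanonical I v = γ := ⟨_, flatCanonical_sharpCanonical γ⟩
    have hv := (mem_extendedJets_iff hp v).1 ((flatCanonical_mem_affineSubbundle_iff hp v).1 hγ)
    refine mfderiv_differential_ne_zero hq (v := v) (by rw [hv]; exact one_ne_zero) ?_
    have h1 := mfderiv_comp v (hf.mdifferentiable (by simp) (flatCanonical I v))
      (contMDiff_flatCanonical.mdifferentiable (by simp) v)
    have h2 : f ∘ flatCanonical I = differential (cotModel I) (p ∘ cotProj I) := funext hff
    rw [h2, h0] at h1
    exact h1.trans (ContinuousLinearMap.zero_comp _)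

end Existence

end Submanifolds

/-! ### Restriction to submanifolds -/

section Restriction

variable {E : Type*} [NormedAddCommGroup E] [NormedSpace ℝ E] {H : Type*} [TopologicalSpace H]
  {I : ModelWithCorners ℝ E H} {N : Type*} [TopologicalSpace N] [ChartedSpace H N]
  {E' : Type*} [NormedAddCommGroup E'] [NormedSpace ℝ E'] {H' : Type*} [TopologicalSpace H']
  {I' : ModelWithCorners ℝ E' H'} {N' : Type*} [TopologicalSpace N'] [ChartedSpace H' N']
  {F : Type*} [NormedAddCommGroup F] [NormedSpace ℝ F]
  {S : Set N} [c : ChartedSpace F S] {S' : Set N'} [c' : ChartedSpace F S']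

theorem IsEmbeddedSubmanifold.contMDiff_coe (hS : IsEmbeddedSubmanifold I S c) :
    ContMDiff 𝓘(ℝ, F) I ∞ ((↑) : S → N) :=
  hS.isSmoothEmbedding.contMDiff

/-- A smooth map sending a submanifold into another one restricts to a smooth map. -/
theorem IsEmbeddedSubmanifold.contMDiff_mapsTo (hS : IsEmbeddedSubmanifold I S c)
    (hS' : IsEmbeddedSubmanifold I' S' c') {f : N → N'} (hf : ContMDiff I I' ∞ f)
    (h : ∀ z : S, f z ∈ S') :
    ContMDiff 𝓘(ℝ, F) 𝓘(ℝ, F) ∞ fun z : S => (⟨f z, h z⟩ : S') := by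
  have h1 : ContMDiff 𝓘(ℝ, F) I' ∞ fun z : S => f z := hf.comp hS.contMDiff_coe
  exact (ContMDiff.iff_comp_isImmersion hS'.isSmoothEmbedding.isImmersion).2
    ⟨Continuous.subtype_mk h1.continuous h, h1⟩

/-- The restriction of a diffeomorphism to corresponding embedded submanifolds. -/
def restrictDiffeomorph (Φ : N ≃ₘ^∞⟮I, I'⟯ N') (hS : IsEmbeddedSubmanifold I S c)
    (hS' : IsEmbeddedSubmanifold I' S' c') (h : ∀ z, Φ z ∈ S' ↔ z ∈ S) :
    S ≃ₘ^∞⟮𝓘(ℝ, F), 𝓘(ℝ, F)⟯ S' where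
  toFun z := ⟨Φ z, (h z).2 z.2⟩
  invFun γ := ⟨Φ.symm γ, (h _).1 (by rw [Φ.apply_symm_apply]; exact γ.2)⟩
  left_inv z := Subtype.ext (Φ.symm_apply_apply z.val)
  right_inv γ := Subtype.ext (Φ.apply_symm_apply γ.val)
  contMDiff_toFun := hS.contMDiff_mapsTo hS' Φ.contMDiff _
  contMDiff_invFun := hS'.contMDiff_mapsTo hS Φ.symm.contMDiff _

theorem pullback_restrictDiffeomorph (Φ : N ≃ₘ^∞⟮I, I'⟯ N') (hS : IsEmbeddedSubmanifold I S c)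
    (hS' : IsEmbeddedSubmanifold I' S' c') (h : ∀ z, Φ z ∈ S' ↔ z ∈ S) {k : ℕ}
    (θ : DForm I' N' k) :
    pullback 𝓘(ℝ, F) 𝓘(ℝ, F) (restrictDiffeomorph Φ hS hS' h)
      (pullback 𝓘(ℝ, F) I' Subtype.val θ) =
      pullback 𝓘(ℝ, F) I Subtype.val (pullback I I' Φ θ) := by
  rw [← pullback_comp θ (hS'.contMDiff_coe.mdifferentiable (by simp))
    ((restrictDiffeomorph Φ hS hS' h).contMDiff.mdifferentiable (by simp)),
    ← pullback_comp θ (Φ.contMDiff.mdifferentiable (by simp))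
    (hS.contMDiff_coe.mdifferentiable (by simp))]
  rfl

end Restriction

section CanonicalForms

variable {E : Type*} [NormedAddCommGroup E] [NormedSpace ℝ E] {H : Type*} [TopologicalSpace H]
  {I : ModelWithCorners ℝ E H} {N : Type*} [TopologicalSpace N] [ChartedSpace H N]
  [IsManifold I ∞ N] [I.Boundaryless] {p : N → ℝ}
  {F : Type*} [NormedAddCommGroup F] [NormedSpace ℝ F]

theorem IsPresymplectic.completeLift {θ : DForm I N 2} (hθ : IsPresymplectic I θ) :
    IsPresymplectic I.tangent (completeLift I θ) := by
  rw [completeLift_eq_extD hθ.closed]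
  exact isPresymplectic_extD hθ.smooth.tautContract

theorem isPresymplectic_jetForm [c : ChartedSpace F (extendedJets I p)]
    (hJ : IsEmbeddedSubmanifold (cotModel I).tangent (extendedJets I p) c) :
    IsPresymplectic 𝓘(ℝ, F) (jetForm I p : DForm 𝓘(ℝ, F) (extendedJets I p) 2) := by
  have := hJ.isManifold
  exact isPresymplectic_canonicalForm.completeLift.pullback hJ.contMDiff_coe

theorem isPresymplectic_affineForm [c : ChartedSpace F (affineSubbundle I p)]
    (hW : IsEmbeddedSubmanifold (cotModel (cotModel I)) (affineSubbundle I p) c) :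
    IsPresymplectic 𝓘(ℝ, F) (affineForm I p : DForm 𝓘(ℝ, F) (affineSubbundle I p) 2) := by
  have := hW.isManifold
  exact isPresymplectic_canonicalForm.pullback hW.contMDiff_coe

variable [FiniteDimensional ℝ E]

/-- On the submanifolds `♭` is anti-presymplectic because it is so on the ambient bundles. -/
theorem pullback_flatDiffeomorph_affineForm [cJ : ChartedSpace F (extendedJets I p)]
    [cW : ChartedSpace F (affineSubbundle I p)] (hp : ContMDiff I 𝓘(ℝ, ℝ) ∞ p)
    (hJ : IsEmbeddedSubmanifold (cotModel I).tangent (extendedJets I p) cJ)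
    (hW : IsEmbeddedSubmanifold (cotModel (cotModel I)) (affineSubbundle I p) cW) :
    pullback 𝓘(ℝ, F) 𝓘(ℝ, F) (restrictDiffeomorph flatDiffeomorph hJ hW
      (flatCanonical_mem_affineSubbundle_iff hp)) (affineForm I p) = -jetForm I p := by
  refine (pullback_restrictDiffeomorph flatDiffeomorph hJ hW
    (flatCanonical_mem_affineSubbundle_iff hp) (canonicalForm (cotModel I))).trans ?_
  refine (congrArg (pullback 𝓘(ℝ, F) (cotModel I).tangent Subtype.val)
    (pullback_flat_canonicalForm isPresymplectic_canonicalForm contMDiff_flatCanonical)).trans ?_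
  rfl

end CanonicalForms

end TDMech

end

theorem mainTheorem4 (n : ℕ) {E : Type*} [NormedAddCommGroup E] [NormedSpace ℝ E]
    [FiniteDimensional ℝ E] (hE : Module.finrank ℝ E = n + 1)
    {M : Type*} [TopologicalSpace M] [ChartedSpace E M] [IsManifold 𝓘(ℝ, E) ∞ M]
    (p : M → ℝ) (hp : IsFibration 𝓘(ℝ, E) p) :
    -- the two spaces are embedded submanifolds of dimension `4n + 3`
    (∃ cJ : ChartedSpace (EuclideanSpace ℝ (Fin (4 * n + 3))) (extendedJets 𝓘(ℝ, E) p),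
      IsEmbeddedSubmanifold (cotModel 𝓘(ℝ, E)).tangent (extendedJets 𝓘(ℝ, E) p) cJ) ∧
    (∃ cW : ChartedSpace (EuclideanSpace ℝ (Fin (4 * n + 3))) (affineSubbundle 𝓘(ℝ, E) p),
      IsEmbeddedSubmanifold (cotModel (cotModel 𝓘(ℝ, E))) (affineSubbundle 𝓘(ℝ, E) p) cW) ∧
    -- and for their structures of embedded submanifolds the following holds
    ∀ (cJ : ChartedSpace (EuclideanSpace ℝ (Fin (4 * n + 3))) (extendedJets 𝓘(ℝ, E) p))
      (cW : ChartedSpace (EuclideanSpace ℝ (Fin (4 * n + 3))) (affineSubbundle 𝓘(ℝ, E) p)),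
      IsEmbeddedSubmanifold (cotModel 𝓘(ℝ, E)).tangent (extendedJets 𝓘(ℝ, E) p) cJ →
      IsEmbeddedSubmanifold (cotModel (cotModel 𝓘(ℝ, E))) (affineSubbundle 𝓘(ℝ, E) p) cW →
      IsPresymplectic (𝓡 (4 * n + 3)) (jetForm 𝓘(ℝ, E) p) ∧
      IsPresymplectic (𝓡 (4 * n + 3)) (affineForm 𝓘(ℝ, E) p) ∧
      ∃ b : extendedJets 𝓘(ℝ, E) p
          ≃ₘ^∞⟮𝓡 (4 * n + 3), 𝓡 (4 * n + 3)⟯ affineSubbundle 𝓘(ℝ, E) p,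
        (∀ z : extendedJets 𝓘(ℝ, E) p, (b z).val = flatCanonical 𝓘(ℝ, E) z.val) ∧
        pullback (𝓡 (4 * n + 3)) (𝓡 (4 * n + 3)) b (affineForm 𝓘(ℝ, E) p) =
          -jetForm 𝓘(ℝ, E) p := by
  have hd : 4 * Module.finrank ℝ E =
      Module.finrank ℝ (EuclideanSpace ℝ (Fin (4 * n + 3))) + 1 := by
    rw [hE, finrank_euclideanSpace_fin]
    ring
  exact ⟨exists_isEmbeddedSubmanifold_extendedJets hd hp.smooth,
    exists_isEmbeddedSubmanifold_affineSubbundle hd hp.smooth,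
    fun cJ cW hJ hW => ⟨isPresymplectic_jetForm hJ, isPresymplectic_affineForm hW,
      restrictDiffeomorph flatDiffeomorph hJ hW (flatCanonical_mem_affineSubbundle_iff hp.smooth),
      fun z => rfl, pullback_flatDiffeomorph_affineForm hp.smooth hJ hW⟩⟩
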